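/- All graphs are finite and simple. A dominating set of a graph $G$ is a set $S\subseteq V(G)$ such that every vertex not in $S$ has a neighbor in $S$; the independent domination number $i(G)$ is the minimum size of a dominating set of $G$ that is also independent. A graph is cubic if every vertex has degree $3$. A graph has no $4$-cycles if it contains no cycle of length $4$ as a (not necessarily induced) subgraph. **Theorem.** If $G$ is a cubic graph with no $4$-cycles, then $$i(G)\le \tfrac{5}{14}\,|V(G)|.$$ In particular, every cubic graph $G$ with at least one vertex and girth at least $6$ has no $4$-cycles and satisfies $i(G)\le \frac{5}{14}|V(G)|<\frac{4}{11}|V(G)|$, which improves the bound $i(G)\le\frac{4}{11}|V(G)|$ of Abrishami and Henning for such graphs. Moreover, the bound $\frac{5}{14}$ is tight: there is a cubic graph $G$ with $14$ vertices, girth $5$ (hence with no $4$-cycles) and $i(G)=5$. -/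

import Mathlib

namespace SimpleGraph

variable {V : Type*}

/-- A set `S` of vertices is dominating if each vertex not in `S` has a neighbor in `S`. -/
def IsDominatingSet (G : SimpleGraph V) (S : Set V) : Prop :=
  ∀ v, v ∉ S → ∃ u ∈ S, G.Adj v u

/-- An independent dominating set: a dominating set that is also independent. -/
def IsIndepDominatingSet (G : SimpleGraph V) (S : Set V) : Prop :=
  G.IsDominatingSet S ∧ G.IsIndepSet S

/-- The independent domination number `i(G)`: the minimum size of an independent dominating set.
For finite graphs this minimum exists, see `exists_isIndepDominatingSet_card_eq`. -/
noncomputable def indepDomNum (G : SimpleGraph V) : ℕ :=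
  sInf {n | ∃ S : Finset V, G.IsIndepDominatingSet (S : Set V) ∧ S.card = n}

/-- `G` has no cycle of length four (as a subgraph, not necessarily induced). -/
def HasNoFourCycle (G : SimpleGraph V) : Prop :=
  ∀ (v : V) (c : G.Walk v v), c.IsCycle → c.length ≠ 4

theorem exists_isIndepDominatingSet [Finite V] (G : SimpleGraph V) :
    ∃ S : Finset V, G.IsIndepDominatingSet (S : Set V) := by
  classical
  have := Fintype.ofFinite V
  obtain ⟨S, hS⟩ := (Set.toFinite {S : Finset V | G.IsIndepSet (S : Set V)}).exists_maximal
    ⟨∅, by simp⟩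
  refine ⟨S, fun v hv => ?_, hS.prop⟩
  by_contra! h
  have hins : G.IsIndepSet ((insert v S : Finset V) : Set V) := by
    rw [Finset.coe_insert, isIndepSet_iff, Set.pairwise_insert]
    exact ⟨hS.prop, fun u hu _ => ⟨h u hu, fun huv => h u hu huv.symm⟩⟩
  exact hv (hS.le_of_ge hins (Finset.subset_insert v S) (Finset.mem_insert_self v S))

/-- In a finite graph the minimum defining `i(G)` is attained. -/
theorem exists_isIndepDominatingSet_card_eq [Finite V] (G : SimpleGraph V) :
    ∃ S : Finset V, G.IsIndepDominatingSet (S : Set V) ∧ S.card = G.indepDomNum := by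
  obtain ⟨S, hS⟩ := G.exists_isIndepDominatingSet
  exact Nat.sInf_mem (s := {n | ∃ S : Finset V, G.IsIndepDominatingSet (S : Set V) ∧ S.card = n})
    ⟨S.card, S, hS, rfl⟩

end SimpleGraph

/-! ## Partially known graphs -/

/-- A partially known subcubic graph: the `i`-th entry holds the degree of the vertex `i`
(`0` if it is unknown) and the list of its known neighbours. -/
abbrev PGraph := List (ℕ × List ℕ)

namespace PGraph

/-- Membership in a list, fast in the kernel. -/
def memB (a : ℕ) : List ℕ → Bool
  | [] => false
  | b :: l => Nat.beq a b || memB a l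

def nodupB : List ℕ → Bool
  | [] => true
  | a :: l => !memB a l && nodupB l

def dedupB : List ℕ → List ℕ
  | [] => []
  | a :: l => if memB a l then dedupB l else a :: dedupB l

def deg (s : PGraph) (i : ℕ) : ℕ := (s.getD i (0, [])).1

def nbs (s : PGraph) (i : ℕ) : List ℕ := (s.getD i (0, [])).2

/-- The degree of `i` and all its neighbours are known. -/
def full (s : PGraph) (i : ℕ) : Bool := Nat.blt 0 (s.deg i) && Nat.beq (s.nbs i).length (s.deg i)

/-- All neighbours of `i` are known. -/
def closed (s : PGraph) (i : ℕ) : Bool :=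
  match s.deg i with
  | 0 => Nat.ble 3 (s.nbs i).length
  | d + 1 => Nat.ble (d + 1) (s.nbs i).length

def addNb (s : PGraph) (i j : ℕ) : PGraph := s.modify i fun c => (c.1, j :: c.2)

/-- The ends of the walks `v, x, y, u` with `y ≠ v` and `u ≠ x`. -/
def walkEnds (s : PGraph) (v : ℕ) : List ℕ :=
  (s.nbs v).flatMap fun x => ((s.nbs x).filter (!Nat.beq · v)).flatMap
    fun y => (s.nbs y).filter (!Nat.beq · x)

/-- The ways to reveal the degree of `v`, or a further neighbour of `v` if the degree is known. -/
def children (s : PGraph) (v : ℕ) : List PGraph :=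
  match s.deg v with
  | 0 => ([1, 2, 3].filter ((s.nbs v).length.ble ·)).map fun d => s.modify v fun c => (d, c.2)
  | _ + 1 =>
    let bad := v :: (s.nbs v ++ s.walkEnds v)
    ((List.range s.length).filter fun u => !(memB u bad || s.closed u)).map
      (fun u => (s.addNb u v).addNb v u) ++ [s.addNb v s.length ++ [(0, [v])]]

def canReveal (s : PGraph) (v : ℕ) : Bool :=
  match s.deg v with
  | 0 => Nat.ble 1 (s.nbs v).length
  | d + 1 => (s.nbs v).length.ble d

/-- The weight of a vertex of the given degree. -/
def weight : ℕ → ℕ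
  | 0 => 14
  | 1 => 9
  | 2 => 6
  | _ => 5

/-- The most that the weight of a vertex of degree `d` (any degree if `d = 0`) can grow when it
loses `h` neighbours. -/
def cost : ℕ → ℕ → ℕ
  | _, 0 => 0
  | 0, 1 => 5
  | 0, 2 => 8
  | 0, _ => 9
  | d, h => weight (d - h) - weight d

def nbhd (s : PGraph) (S : List ℕ) : List ℕ := dedupB (S ++ S.flatMap s.nbs)

/-- The closed neighbourhood of the independent set `S` can be deleted. -/
def reducible (s : PGraph) (S : List ℕ) : Bool :=
  let X := s.nbhd S
  !S.isEmpty && nodupB S && S.all (fun a => (s.nbs a).all fun b => !memB b S) && X.all s.full &&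
  Nat.ble (14 * S.length + (((List.range s.length).filter fun y => !memB y X).map
      fun y => cost (s.deg y) ((s.nbs y).countP (memB · X))).sum)
    ((X.map fun x => weight (s.deg x)).sum)

/-- `m` embeds `P` into `s`. -/
def embeds (P s : PGraph) (m : List ℕ) : Bool :=
  Nat.beq m.length P.length && nodupB m && m.all (fun x => Nat.blt x s.length) &&
  (List.range P.length).all fun i =>
    let x := m.getD i 0
    (Nat.beq (P.deg i) 0 || Nat.beq (P.deg i) (s.deg x)) &&
    (P.nbs i).all fun j => memB (m.getD j 0) (s.nbs x)

def wf (s : PGraph) : Bool :=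
  (List.range s.length).all fun i => nodupB (s.nbs i) &&
    (s.nbs i).all fun j => Nat.blt j s.length && !Nat.beq j i && memB i (s.nbs j)

/-- Reads a proof that no partial graph of the stack occurs; returns the unread part. -/
def run (known : List PGraph) : ℕ → List ℕ → List PGraph → Option (List ℕ)
  | _, ts, [] => some ts
  | f + 1, t :: ts, s :: st =>
    match t, ts with
    | 0, v :: ts => if s.canReveal v then run known f ts (s.children v ++ st) else none
    | t + 1, ts =>
      if Nat.blt t 4 then
        if s.reducible (ts.take (t + 1)) then run known f (ts.drop (t + 1)) st else none
      else match ts with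
        | [] => none
        | i :: ts =>
          match known[(t - 4) * 60 + i]? with
          | none => none
          | some P => if embeds P s (ts.take P.length) then run known f (ts.drop P.length) st
            else none
    | _, _ => none
  | _, _, _ => none

def addEdges : ℕ → PGraph → List ℕ → PGraph × List ℕ
  | e + 1, s, a :: b :: ts => addEdges e ((s.addNb a b).addNb b a) ts
  | _, s, ts => (s, ts)

/-- Reads a partial graph. -/
def read : List ℕ → PGraph × List ℕ
  | n :: ts => match ts.drop n with
    | e :: ts' => addEdges e ((ts.take n).map fun d => (d, [])) ts'
    | [] => ([], [])
  | [] => ([], [])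

/-- Reads partial graphs with proofs that they do not occur, and adds them to `known`. -/
def checkAll : ℕ → List PGraph → List ℕ → Option (List PGraph)
  | _, known, [] => some known
  | f + 1, known, ts =>
    match read ts with
    | (s, ts) => if s.wf then
        match run known 2000 ts [s] with
        | some ts => checkAll f (s :: known) ts
        | none => none
      else none
  | 0, _, _ => none

/-- The digits of `n` in base 64, diminished by 1. -/
def digits : ℕ → ℕ → List ℕ
  | 0, _ => []
  | f + 1, n => match n with
    | 0 => []
    | n + 1 => ((n + 1) % 64 - 1) :: digits f ((n + 1) / 64)

def checkCert (known goals : List PGraph) (cert : List ℕ) : Bool :=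
  match checkAll 1000 known (cert.flatMap (digits 100)) with
  | some K => goals.all K.elem
  | none => false

end PGraph

namespace PGraph

theorem memB_iff {a : ℕ} {l : List ℕ} : memB a l = true ↔ a ∈ l := by
  induction l with
  | nil => simp [memB]
  | cons b l ih => simp [memB, ih, Nat.beq_eq]

theorem memB_eq_false {a : ℕ} {l : List ℕ} : memB a l = false ↔ a ∉ l := by
  rw [← memB_iff, Bool.not_eq_true]

theorem nodupB_iff {l : List ℕ} : nodupB l = true ↔ l.Nodup := by
  induction l with
  | nil => simp [nodupB]
  | cons b l ih => simp [nodupB, ih, memB_eq_false]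

theorem mem_dedupB {a : ℕ} {l : List ℕ} : a ∈ dedupB l ↔ a ∈ l := by
  induction l with
  | nil => simp [dedupB]
  | cons b l ih =>
    unfold dedupB
    split_ifs with h
    · rw [memB_iff] at h
      rw [ih, List.mem_cons]
      exact ⟨Or.inr, fun h' => h'.elim (fun e => e ▸ h) id⟩
    · simp [ih]

theorem nodup_dedupB (l : List ℕ) : (dedupB l).Nodup := by
  induction l with
  | nil => simp [dedupB]
  | cons b l ih =>
    unfold dedupB
    split_ifs with h
    · exact ih
    · rw [memB_iff] at h
      simp [ih, mem_dedupB, h]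

variable {s : PGraph}

theorem nbs_of_le {i : ℕ} (h : s.length ≤ i) : s.nbs i = [] := by
  simp [nbs, List.getD_eq_getElem?_getD, List.getElem?_eq_none h]

theorem deg_of_le {i : ℕ} (h : s.length ≤ i) : s.deg i = 0 := by
  simp [deg, List.getD_eq_getElem?_getD, List.getElem?_eq_none h]

@[simp] theorem length_addNb (i j : ℕ) : (s.addNb i j).length = s.length := by simp [addNb]

@[simp] theorem deg_addNb (i j k : ℕ) : (s.addNb i j).deg k = s.deg k := by
  simp only [deg, addNb, List.getD_eq_getElem?_getD, List.getElem?_modify]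
  by_cases h : i = k
  · subst h; cases s[i]? <;> simp
  · simp [h]

theorem nbs_addNb (i j k : ℕ) (hi : i < s.length) :
    (s.addNb i j).nbs k = if i = k then j :: s.nbs k else s.nbs k := by
  simp only [nbs, addNb, List.getD_eq_getElem?_getD, List.getElem?_modify]
  by_cases h : i = k
  · subst h; simp [hi]
  · simp [h]

theorem nbs_modify_deg (v d k : ℕ) : PGraph.nbs (s.modify v fun c => (d, c.2)) k = s.nbs k := by
  simp only [nbs, List.getD_eq_getElem?_getD, List.getElem?_modify]
  by_cases h : v = k
  · subst h; cases s[v]? <;> simp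
  · simp [h]

theorem deg_modify_deg (v d k : ℕ) (hv : v < s.length) :
    PGraph.deg (s.modify v fun c => (d, c.2)) k = if v = k then d else s.deg k := by
  simp only [deg, List.getD_eq_getElem?_getD, List.getElem?_modify]
  by_cases h : v = k
  · subst h; simp [hv]
  · simp [h]

theorem nbs_append (c : ℕ × List ℕ) (k : ℕ) :
    PGraph.nbs (s ++ [c]) k = if k = s.length then c.2 else s.nbs k := by
  simp only [nbs, List.getD_eq_getElem?_getD, List.getElem?_append]
  split_ifs with h1 h2 h2
  · omega
  · rfl
  · subst h2; simp
  · rw [List.getElem?_eq_none (by simp; omega), List.getElem?_eq_none (by omega)]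

theorem deg_append (c : ℕ × List ℕ) (k : ℕ) :
    PGraph.deg (s ++ [c]) k = if k = s.length then c.1 else s.deg k := by
  simp only [deg, List.getD_eq_getElem?_getD, List.getElem?_append]
  split_ifs with h1 h2 h2
  · omega
  · rfl
  · subst h2; simp
  · rw [List.getElem?_eq_none (by simp; omega), List.getElem?_eq_none (by omega)]

/-- Neighbour lists are duplicate free and symmetric. -/
structure WF (s : PGraph) : Prop where
  nodup : ∀ i, (s.nbs i).Nodup
  lt : ∀ {i j}, j ∈ s.nbs i → j < s.length
  ne : ∀ {i j}, j ∈ s.nbs i → j ≠ i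
  symm : ∀ {i j}, j ∈ s.nbs i → i ∈ s.nbs j

theorem wf_sound (h : s.wf = true) : s.WF := by
  have key : ∀ i, (s.nbs i).Nodup ∧ ∀ j ∈ s.nbs i, j < s.length ∧ j ≠ i ∧ i ∈ s.nbs j := by
    intro i
    rcases lt_or_ge i s.length with hi | hi
    · have := List.all_eq_true.1 h i (List.mem_range.2 hi)
      simpa [nodupB_iff, memB_iff, Nat.blt_eq, Nat.beq_eq, and_assoc, ← Bool.not_eq_true] using this
    · rw [nbs_of_le hi]; simp
  exact ⟨fun i => (key i).1, fun hj => ((key _).2 _ hj).1, fun hj => ((key _).2 _ hj).2.1,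
    fun hj => ((key _).2 _ hj).2.2⟩

theorem WF.addEdge (h : s.WF) {u v : ℕ} (hu : u < s.length) (hv : v < s.length) (huv : u ≠ v)
    (hn : u ∉ s.nbs v) : ((s.addNb u v).addNb v u).WF := by
  have hn' : v ∉ s.nbs u := fun h' => hn (h.symm h')
  have key : ∀ i, ((s.addNb u v).addNb v u).nbs i =
      if v = i then u :: s.nbs i else if u = i then v :: s.nbs i else s.nbs i := by
    intro i
    rw [nbs_addNb _ _ _ (by simpa using hv), nbs_addNb _ _ _ hu]
    by_cases h1 : v = i
    · subst h1; simp [huv]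
    · simp [h1]
  refine ⟨fun i => ?_, fun {i j} hj => ?_, fun {i j} hj => ?_, fun {i j} hj => ?_⟩
  · rw [key]
    split_ifs with h1 h2
    · subst h1; exact List.nodup_cons.2 ⟨hn, h.nodup _⟩
    · subst h2; exact List.nodup_cons.2 ⟨hn', h.nodup _⟩
    · exact h.nodup _
  · simp only [length_addNb]
    rw [key] at hj
    split_ifs at hj with h1 h2
    · rcases List.mem_cons.1 hj with rfl | hj
      · exact hu
      · exact h.lt hj
    · rcases List.mem_cons.1 hj with rfl | hj
      · exact hv
      · exact h.lt hj
    · exact h.lt hj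
  · rw [key] at hj
    split_ifs at hj with h1 h2
    · rcases List.mem_cons.1 hj with rfl | hj
      · exact h1 ▸ huv
      · exact h.ne hj
    · rcases List.mem_cons.1 hj with rfl | hj
      · exact h2 ▸ huv.symm
      · exact h.ne hj
    · exact h.ne hj
  · rw [key] at hj ⊢
    have aux : i ∈ s.nbs j → i ∈ (if v = j then u :: s.nbs j else
        if u = j then v :: s.nbs j else s.nbs j) := by
      intro h'; split_ifs <;> simp [h']
    split_ifs at hj with h1 h2
    · rcases List.mem_cons.1 hj with rfl | hj
      · subst h1; simp [huv.symm]
      · exact aux (h.symm hj)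
    · rcases List.mem_cons.1 hj with rfl | hj
      · subst h2; simp
      · exact aux (h.symm hj)
    · exact aux (h.symm hj)

theorem WF.addVertex (h : s.WF) {v : ℕ} (hv : v < s.length) :
    WF (s.addNb v s.length ++ [(0, [v])]) := by
  have key : ∀ i, PGraph.nbs (s.addNb v s.length ++ [(0, [v])]) i =
      if i = s.length then [v] else if v = i then s.length :: s.nbs i else s.nbs i := by
    intro i
    rw [nbs_append, nbs_addNb _ _ _ hv, length_addNb]
  have hs : ∀ i, s.length ∉ s.nbs i := fun i h' => (h.lt h').false
  refine ⟨fun i => ?_, fun {i j} hj => ?_, fun {i j} hj => ?_, fun {i j} hj => ?_⟩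
  · rw [key]
    split_ifs with h1 h2
    · simp
    · exact List.nodup_cons.2 ⟨hs _, h.nodup _⟩
    · exact h.nodup _
  · simp only [List.length_append, length_addNb, List.length_singleton]
    rw [key] at hj
    split_ifs at hj with h1 h2
    · simp at hj; omega
    · rcases List.mem_cons.1 hj with rfl | hj
      · omega
      · have := h.lt hj; omega
    · have := h.lt hj; omega
  · rw [key] at hj
    split_ifs at hj with h1 h2
    · simp at hj; omega
    · rcases List.mem_cons.1 hj with rfl | hj
      · omega
      · exact h.ne hj
    · exact h.ne hj
  · rw [key] at hj ⊢
    split_ifs at hj with h1 h2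
    · simp at hj; subst hj h1; simp [hv.ne]
    · rcases List.mem_cons.1 hj with rfl | hj
      · simp [h2]
      · have h3 := h.lt hj
        have h4 := h.symm hj
        rw [if_neg h3.ne]; split_ifs <;> simp [h4]
    · have h3 := h.lt hj
      have h4 := h.symm hj
      rw [if_neg h3.ne]; split_ifs <;> simp [h4]

theorem WF.modify_deg (h : s.WF) (v d : ℕ) : WF (s.modify v fun c => (d, c.2)) := by
  refine ⟨fun i => ?_, fun {i j} hj => ?_, fun {i j} hj => ?_, fun {i j} hj => ?_⟩
  · rw [nbs_modify_deg]; exact h.nodup i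
  · rw [nbs_modify_deg] at hj; simpa using h.lt hj
  · rw [nbs_modify_deg] at hj; exact h.ne hj
  · rw [nbs_modify_deg] at hj ⊢; exact h.symm hj

theorem lt_of_canReveal {v : ℕ} (h : s.canReveal v = true) : v < s.length := by
  by_contra! hv
  simp [canReveal, deg_of_le hv, nbs_of_le hv] at h

theorem mem_children_stub {v d : ℕ} (hd : s.deg v = d + 1) {c : PGraph} :
    c ∈ s.children v ↔
      (∃ u < s.length, u ≠ v ∧ u ∉ s.nbs v ∧ u ∉ s.walkEnds v ∧ s.closed u = false ∧
        c = (s.addNb u v).addNb v u) ∨ c = s.addNb v s.length ++ [(0, [v])] := by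
  simp only [children, hd, List.mem_append, List.mem_map, List.mem_filter, List.mem_range,
    List.not_mem_nil, or_false, Bool.not_or, Bool.and_eq_true, Bool.not_eq_true', memB_eq_false,
    List.mem_cons, not_or]
  constructor
  · rintro (⟨u, ⟨h1, ⟨h2, h3, h4⟩, h5⟩, rfl⟩ | h)
    · exact Or.inl ⟨u, h1, h2, h3, h4, h5, rfl⟩
    · exact Or.inr h
  · rintro (⟨u, h1, h2, h3, h4, h5, rfl⟩ | h)
    · exact Or.inl ⟨u, ⟨h1, ⟨h2, h3, h4⟩, h5⟩, rfl⟩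
    · exact Or.inr h

theorem mem_children_deg {v : ℕ} (hd : s.deg v = 0) {c : PGraph} :
    c ∈ s.children v ↔ ∃ d, (d = 1 ∨ d = 2 ∨ d = 3) ∧ (s.nbs v).length ≤ d ∧
      c = s.modify v fun c => (d, c.2) := by
  simp only [children, hd, List.mem_map, List.mem_filter, Nat.ble_eq, List.mem_cons,
    List.not_mem_nil, or_false]
  constructor
  · rintro ⟨d, ⟨h1, h2⟩, rfl⟩; exact ⟨d, h1, h2, rfl⟩
  · rintro ⟨d, h1, h2, rfl⟩; exact ⟨d, ⟨h1, h2⟩, rfl⟩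

theorem WF.children (h : s.WF) {v : ℕ} (hv : s.canReveal v = true) {c : PGraph}
    (hc : c ∈ s.children v) : c.WF := by
  have hl := lt_of_canReveal hv
  rcases hd : s.deg v with _ | d
  · obtain ⟨d, -, -, rfl⟩ := (mem_children_deg hd).1 hc
    exact h.modify_deg v d
  · rcases (mem_children_stub hd).1 hc with ⟨u, hu, huv, hn, -, -, rfl⟩ | rfl
    · exact h.addEdge hu hl huv hn
    · exact h.addVertex hl

end PGraph

namespace SimpleGraph

section MinCex

open scoped Classical

variable {V : Type*}

/-- The neighbours of `v` in `U`. -/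
noncomputable def nbrIn (G : SimpleGraph V) (U : Finset V) (v : V) : Finset V := U.filter (G.Adj v)

theorem mem_nbrIn {G : SimpleGraph V} {U : Finset V} {v w : V} :
    w ∈ G.nbrIn U v ↔ w ∈ U ∧ G.Adj v w := Finset.mem_filter

/-- The graph induced on `U` is subcubic without 4-cycles. -/
structure Admissible (G : SimpleGraph V) (U : Finset V) : Prop where
  card_le : ∀ v ∈ U, (G.nbrIn U v).card ≤ 3
  eq_or_eq : ∀ {a b c d}, a ∈ U → b ∈ U → c ∈ U → d ∈ U →
    G.Adj a b → G.Adj b c → G.Adj c d → G.Adj d a → a = c ∨ b = d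

/-- The total weight of the graph induced on `U`. -/
noncomputable def totalWeight (G : SimpleGraph V) (U : Finset V) : ℕ :=
  ∑ v ∈ U, PGraph.weight (G.nbrIn U v).card

/-- The graph induced on `U` has an independent dominating set with at most `k` vertices. -/
def HasIDS (G : SimpleGraph V) (U : Finset V) (k : ℕ) : Prop :=
  ∃ I ⊆ U, (∀ a ∈ I, ∀ b ∈ I, ¬ G.Adj a b) ∧ (∀ v ∈ U, v ∉ I → ∃ u ∈ I, G.Adj v u) ∧ I.card ≤ k

/-- The weight bounds the size of some independent dominating set. -/
def WeightBound (G : SimpleGraph V) (U : Finset V) : Prop :=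
  ∃ k, G.HasIDS U k ∧ 14 * k ≤ G.totalWeight U

/-- A counterexample to the weight bound with as few vertices as possible. -/
structure MinCex (G : SimpleGraph V) (U : Finset V) : Prop where
  adm : G.Admissible U
  not_bound : ¬ G.WeightBound U
  bound : ∀ (G' : SimpleGraph V) (U' : Finset V), U'.card < U.card → G'.Admissible U' →
    G'.WeightBound U'

variable {G : SimpleGraph V} {U : Finset V}

theorem nbrIn_mono {U' : Finset V} (h : U' ⊆ U) (v : V) : G.nbrIn U' v ⊆ G.nbrIn U v :=
  Finset.filter_subset_filter _ h

theorem Admissible.mono {U' : Finset V} (h : G.Admissible U) (h' : U' ⊆ U) :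
    G.Admissible U' where
  card_le v hv := (Finset.card_le_card (nbrIn_mono h' v)).trans (h.card_le v (h' hv))
  eq_or_eq ha hb hc hd := h.eq_or_eq (h' ha) (h' hb) (h' hc) (h' hd)

theorem MinCex.totalWeight_lt (h : G.MinCex U) {S X : Finset V} (hne : S.Nonempty) (hSX : S ⊆ X)
    (hXU : X ⊆ U) (hind : ∀ a ∈ S, ∀ b ∈ S, ¬ G.Adj a b)
    (hdom : ∀ x ∈ X, x ∉ S → ∃ a ∈ S, G.Adj x a) (hcl : ∀ a ∈ S, ∀ x ∈ U, G.Adj a x → x ∈ X) :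
    G.totalWeight U < 14 * S.card + G.totalWeight (U \ X) := by
  by_contra! hcon
  have hcard : (U \ X).card < U.card := by
    apply Finset.card_lt_card
    refine ⟨Finset.sdiff_subset, fun hss => ?_⟩
    obtain ⟨a, ha⟩ := hne
    exact (Finset.mem_sdiff.1 (hss (hXU (hSX ha)))).2 (hSX ha)
  obtain ⟨k, ⟨I, hIU, hI, hId, hIk⟩, hk⟩ :=
    h.bound G (U \ X) hcard (h.adm.mono Finset.sdiff_subset)
  have hno : ∀ a ∈ S, ∀ b ∈ I, ¬ G.Adj a b := fun a ha b hb hab =>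
    (Finset.mem_sdiff.1 (hIU hb)).2 (hcl a ha b (Finset.mem_sdiff.1 (hIU hb)).1 hab)
  refine h.not_bound ⟨k + S.card, ⟨I ∪ S, ?_, ?_, ?_, ?_⟩, by omega⟩
  · exact Finset.union_subset (hIU.trans Finset.sdiff_subset) (hSX.trans hXU)
  · intro a ha b hb hab
    rcases Finset.mem_union.1 ha with ha | ha <;> rcases Finset.mem_union.1 hb with hb | hb
    · exact hI a ha b hb hab
    · exact hno b hb a ha hab.symm
    · exact hno a ha b hb hab
    · exact hind a ha b hb hab
  · intro v hv hvn
    rw [Finset.mem_union, not_or] at hvn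
    by_cases hvX : v ∈ X
    · obtain ⟨a, ha, hva⟩ := hdom v hvX hvn.2
      exact ⟨a, Finset.mem_union_right _ ha, hva⟩
    · obtain ⟨u, hu, hvu⟩ := hId v (Finset.mem_sdiff.2 ⟨hv, hvX⟩) hvn.1
      exact ⟨u, Finset.mem_union_left _ hu, hvu⟩
  · exact (Finset.card_union_le _ _).trans (by omega)

/-- `φ` places the partial graph `s` in the graph induced on `U`. -/
structure Realizes (G : SimpleGraph V) (U : Finset V) (s : PGraph) (φ : ℕ → V) : Prop where
  mem : ∀ {i}, i < s.length → φ i ∈ U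
  inj : ∀ {i j}, i < s.length → j < s.length → φ i = φ j → i = j
  adj : ∀ {i j}, i < s.length → j ∈ s.nbs i → G.Adj (φ i) (φ j)
  deg : ∀ {i}, i < s.length → s.deg i ≠ 0 → (G.nbrIn U (φ i)).card = s.deg i

/-- The partial graph `s` occurs in the graph induced on `U`. -/
def Occurs (G : SimpleGraph V) (U : Finset V) (s : PGraph) : Prop := ∃ φ, G.Realizes U s φ

variable {s : PGraph} {φ : ℕ → V}

theorem Realizes.image_subset (h : G.Realizes U s φ) (hs : s.WF) {i : ℕ} (hi : i < s.length) :
    (s.nbs i).toFinset.image φ ⊆ G.nbrIn U (φ i) := by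
  intro w hw
  obtain ⟨j, hj, rfl⟩ := Finset.mem_image.1 hw
  rw [List.mem_toFinset] at hj
  exact mem_nbrIn.2 ⟨h.mem (hs.lt hj), h.adj hi hj⟩

theorem Realizes.card_image (h : G.Realizes U s φ) (hs : s.WF) (i : ℕ) :
    ((s.nbs i).toFinset.image φ).card = (s.nbs i).length := by
  rw [Finset.card_image_of_injOn, List.toFinset_card_of_nodup (hs.nodup i)]
  intro a ha b hb hab
  simp only [List.coe_toFinset, Set.mem_ofPred_eq] at ha hb
  exact h.inj (hs.lt ha) (hs.lt hb) hab

theorem Realizes.eq_of_le (h : G.Realizes U s φ) (hs : s.WF) {i : ℕ} (hi : i < s.length)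
    (hle : (G.nbrIn U (φ i)).card ≤ (s.nbs i).length) {w : V} (hw : w ∈ U) (hiw : G.Adj (φ i) w) :
    ∃ j ∈ s.nbs i, φ j = w := by
  have := Finset.eq_of_subset_of_card_le (h.image_subset hs hi) (by rwa [h.card_image hs])
  have hw' : w ∈ (s.nbs i).toFinset.image φ := this ▸ mem_nbrIn.2 ⟨hw, hiw⟩
  obtain ⟨j, hj, rfl⟩ := Finset.mem_image.1 hw'
  exact ⟨j, List.mem_toFinset.1 hj, rfl⟩

theorem Realizes.card_le_of_closed (h : G.Realizes U s φ) (hG : G.Admissible U) {i : ℕ}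
    (hi : i < s.length) (hc : s.closed i = true) :
    (G.nbrIn U (φ i)).card ≤ (s.nbs i).length := by
  unfold PGraph.closed at hc
  rcases hd : s.deg i with _ | d
  · rw [hd] at hc
    exact (hG.card_le _ (h.mem hi)).trans (by simpa using hc)
  · rw [hd] at hc
    rw [h.deg hi (by omega), hd]
    simpa using hc

theorem Realizes.exists_child (h : G.Realizes U s φ) (hs : s.WF) (hG : G.Admissible U) {v : ℕ}
    (hv : s.canReveal v = true) : ∃ c ∈ s.children v, G.Occurs U c := by
  have hl := PGraph.lt_of_canReveal hv
  rcases hd : s.deg v with _ | d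
  · have hc : (s.nbs v).length ≤ (G.nbrIn U (φ v)).card := by
      rw [← h.card_image hs]; exact Finset.card_le_card (h.image_subset hs hl)
    have h1 : 1 ≤ (s.nbs v).length := by simpa [PGraph.canReveal, hd] using hv
    have h3 := hG.card_le _ (h.mem hl)
    refine ⟨_, (PGraph.mem_children_deg hd).2 ⟨(G.nbrIn U (φ v)).card, by omega, hc, rfl⟩, φ, ?_⟩
    refine ⟨fun hi => h.mem (by simpa using hi), fun hi hj => h.inj (by simpa using hi)
      (by simpa using hj), fun hi hj => h.adj (by simpa using hi) ?_, fun {i} hi hd' => ?_⟩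
    · rwa [PGraph.nbs_modify_deg] at hj
    · rw [PGraph.deg_modify_deg _ _ _ hl] at hd' ⊢
      split_ifs with hvi
      · rw [hvi]
      · rw [if_neg hvi] at hd'
        exact h.deg (by simpa using hi) hd'
  · have hlt : (s.nbs v).length < (G.nbrIn U (φ v)).card := by
      rw [h.deg hl (by omega), hd]
      have : (s.nbs v).length ≤ d := by simpa [PGraph.canReveal, hd] using hv
      omega
    obtain ⟨w, hw, hwn⟩ := Finset.exists_mem_notMem_of_card_lt_card
      ((h.card_image hs v).trans_lt hlt)
    obtain ⟨hwU, hvw⟩ := mem_nbrIn.1 hw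
    by_cases hex : ∃ u < s.length, φ u = w
    · obtain ⟨u, hu, rfl⟩ := hex
      have huv : u ≠ v := by rintro rfl; exact G.irrefl hvw
      have hun : u ∉ s.nbs v := fun hu' =>
        hwn (Finset.mem_image_of_mem _ (List.mem_toFinset.2 hu'))
      refine ⟨_, (PGraph.mem_children_stub hd).2 (Or.inl ⟨u, hu, huv, hun, ?_, ?_, rfl⟩), φ, ?_⟩
      · intro hwalk
        simp only [PGraph.walkEnds, List.mem_flatMap, List.mem_filter, Bool.not_eq_true',
          ← Bool.not_eq_true, Nat.beq_eq] at hwalk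
        obtain ⟨x, hx, y, ⟨hy, hyv⟩, hu', hux⟩ := hwalk
        have hxl := hs.lt hx
        have hyl := hs.lt hy
        rcases hG.eq_or_eq (h.mem hl) (h.mem hxl) (h.mem hyl) (h.mem hu) (h.adj hl hx)
          (h.adj hxl hy) (h.adj hyl hu') hvw.symm with he | he
        · exact hyv (h.inj hyl hl he.symm)
        · exact hux (h.inj hu hxl he.symm)
      · by_contra hcl
        obtain ⟨j, hj, hjv⟩ := h.eq_of_le hs hu
          (h.card_le_of_closed hG hu (by simpa using hcl)) (h.mem hl) hvw.symm
        have := h.inj (hs.lt hj) hl hjv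
        subst this
        exact hun (hs.symm hj)
      · refine ⟨fun hi => h.mem (by simpa using hi), fun hi hj => h.inj (by simpa using hi)
          (by simpa using hj), fun {i j} hi hj => ?_, fun hi hd' => ?_⟩
        · rw [PGraph.nbs_addNb _ _ _ (by simpa using hl), PGraph.nbs_addNb _ _ _ hu] at hj
          have hi' : i < s.length := by simpa using hi
          split_ifs at hj with h1 h2 h2
          · subst h1
            exact absurd h2 huv
          · subst h1
            rcases List.mem_cons.1 hj with rfl | hj
            · exact hvw
            · exact h.adj hi' hj
          · subst h2
            rcases List.mem_cons.1 hj with rfl | hj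
            · exact hvw.symm
            · exact h.adj hi' hj
          · exact h.adj hi' hj
        · simp only [PGraph.deg_addNb] at hd' ⊢
          exact h.deg (by simpa using hi) hd'
    · push Not at hex
      refine ⟨_, (PGraph.mem_children_stub hd).2 (Or.inr rfl), Function.update φ s.length w, ?_⟩
      have hφ : ∀ {i}, i < s.length → Function.update φ s.length w i = φ i := fun hi =>
        Function.update_of_ne hi.ne _ _
      have hlen : (s.addNb v s.length ++ [(0, [v])]).length = s.length + 1 := by simp
      refine ⟨fun {i} hi => ?_, fun {i j} hi hj hij => ?_, fun {i j} hi hj => ?_,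
        fun {i} hi hd' => ?_⟩
      · rcases (Nat.lt_succ_iff_lt_or_eq.1 (hlen ▸ hi)) with hi | rfl
        · rw [hφ hi]; exact h.mem hi
        · simpa using hwU
      · rcases (Nat.lt_succ_iff_lt_or_eq.1 (hlen ▸ hi)) with hi | rfl <;>
          rcases (Nat.lt_succ_iff_lt_or_eq.1 (hlen ▸ hj)) with hj | rfl
        · rw [hφ hi, hφ hj] at hij; exact h.inj hi hj hij
        · rw [hφ hi, Function.update_self] at hij; exact absurd hij (hex i hi)
        · rw [hφ hj, Function.update_self] at hij; exact absurd hij.symm (hex j hj)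
        · rfl
      · rw [PGraph.nbs_append, PGraph.nbs_addNb _ _ _ hl, PGraph.length_addNb] at hj
        split_ifs at hj with h1 h2
        · subst h1
          rw [List.mem_singleton.1 hj, hφ hl, Function.update_self]
          exact hvw.symm
        · subst h2
          rcases List.mem_cons.1 hj with rfl | hj
          · rw [hφ hl, Function.update_self]; exact hvw
          · rw [hφ hl, hφ (hs.lt hj)]; exact h.adj hl hj
        · have hi' : i < s.length := by omega
          rw [hφ hi', hφ (hs.lt hj)]; exact h.adj hi' hj
      · rw [PGraph.deg_append, PGraph.length_addNb, PGraph.deg_addNb] at hd' ⊢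
        split_ifs at hd' ⊢ with h1
        · exact absurd rfl hd'
        · have hi' : i < s.length := by omega
          rw [hφ hi']; exact h.deg hi' hd'

end MinCex

end SimpleGraph

namespace PGraph

theorem weight_sub_le {D d h : ℕ} (hD : D ≤ 3) (hd : d = 0 ∨ d = D) (hh : h ≤ D) :
    weight (D - h) ≤ weight D + cost d h := by
  interval_cases D <;> rcases hd with rfl | rfl <;> interval_cases h <;> decide

theorem lt_of_full {s : PGraph} {i : ℕ} (h : s.full i = true) : i < s.length := by
  by_contra! hi
  simp [full, deg_of_le hi] at h

theorem mem_nbhd {s : PGraph} {S : List ℕ} {x : ℕ} :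
    x ∈ s.nbhd S ↔ x ∈ S ∨ ∃ a ∈ S, x ∈ s.nbs a := by
  simp [nbhd, mem_dedupB]

end PGraph

namespace SimpleGraph

open scoped Classical

variable {V : Type*} {G : SimpleGraph V} {U : Finset V} {s : PGraph} {φ : ℕ → V}

theorem Realizes.card_of_full (h : G.Realizes U s φ) {i : ℕ} (hi : s.full i = true) :
    (G.nbrIn U (φ i)).card = s.deg i ∧ (s.nbs i).length = s.deg i := by
  have hl := PGraph.lt_of_full hi
  simp only [PGraph.full, Bool.and_eq_true, Nat.blt_eq, Nat.beq_eq] at hi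
  exact ⟨h.deg hl (by omega), hi.2⟩

theorem Realizes.exists_of_full (h : G.Realizes U s φ) (hs : s.WF) {i : ℕ}
    (hi : s.full i = true) {w : V} (hw : w ∈ U) (hiw : G.Adj (φ i) w) : ∃ j ∈ s.nbs i, φ j = w :=
  h.eq_of_le hs (PGraph.lt_of_full hi)
    ((h.card_of_full hi).1.trans (h.card_of_full hi).2.symm).le hw hiw

theorem Realizes.injOn (h : G.Realizes U s φ) {X : List ℕ} (hX : ∀ x ∈ X, x < s.length) :
    Set.InjOn φ X.toFinset := by
  intro a ha b hb hab
  simp only [List.coe_toFinset, Set.mem_ofPred_eq] at ha hb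
  exact h.inj (hX a ha) (hX b hb) hab

theorem Realizes.mem_image_iff (h : G.Realizes U s φ) {X : List ℕ} (hX : ∀ x ∈ X, x < s.length)
    {i : ℕ} (hi : i < s.length) : φ i ∈ X.toFinset.image φ ↔ i ∈ X := by
  constructor
  · intro hm
    obtain ⟨j, hj, hji⟩ := Finset.mem_image.1 hm
    rw [List.mem_toFinset] at hj
    exact h.inj (hX j hj) hi hji ▸ hj
  · exact fun hi => Finset.mem_image_of_mem _ (List.mem_toFinset.2 hi)

theorem sum_toFinset_image {X : List ℕ} (hX : X.Nodup) (hφ : Set.InjOn φ X.toFinset)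
    (f : V → ℕ) : ∑ v ∈ X.toFinset.image φ, f v = (X.map fun x => f (φ x)).sum := by
  rw [Finset.sum_image hφ, List.sum_toFinset _ hX]

/-- Deleting known vertices `X`, all of whose neighbours are known, costs at most what is
computed from the partial graph. -/
theorem Realizes.totalWeight_sdiff_le (h : G.Realizes U s φ) (hs : s.WF) (hG : G.Admissible U)
    {X : List ℕ} (hX : ∀ x ∈ X, s.full x = true) (hXn : X.Nodup) :
    G.totalWeight (U \ X.toFinset.image φ) + (X.map fun x => PGraph.weight (s.deg x)).sum ≤
      G.totalWeight U + (((List.range s.length).filter fun y => !PGraph.memB y X).map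
        fun y => PGraph.cost (s.deg y) ((s.nbs y).countP (PGraph.memB · X))).sum := by
  have hXl : ∀ x ∈ X, x < s.length := fun x hx => PGraph.lt_of_full (hX x hx)
  set Xf := X.toFinset.image φ with hXf
  set Y := (List.range s.length).filter fun y => !PGraph.memB y X with hY
  have hYmem : ∀ y, y ∈ Y ↔ y < s.length ∧ y ∉ X := by
    intro y; simp [hY, PGraph.memB_eq_false]
  have hYl : ∀ y ∈ Y, y < s.length := fun y hy => ((hYmem y).1 hy).1
  have hYn : Y.Nodup := List.nodup_range.filter _
  have hXU : Xf ⊆ U := by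
    intro v hv
    obtain ⟨x, hx, rfl⟩ := Finset.mem_image.1 hv
    exact h.mem (hXl x (List.mem_toFinset.1 hx))
  have hYU : Y.toFinset.image φ ⊆ U \ Xf := by
    intro v hv
    obtain ⟨y, hy, rfl⟩ := Finset.mem_image.1 hv
    obtain ⟨hy1, hy2⟩ := (hYmem y).1 (List.mem_toFinset.1 hy)
    exact Finset.mem_sdiff.2 ⟨h.mem hy1, fun hm => hy2 ((h.mem_image_iff hXl hy1).1 hm)⟩
  have hsub : ∀ v, G.nbrIn (U \ Xf) v = G.nbrIn U v \ (G.nbrIn U v ∩ Xf) := by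
    intro v; ext w; simp only [mem_nbrIn, Finset.mem_sdiff, Finset.mem_inter]; tauto
  have hrest : ∀ v ∈ (U \ Xf) \ Y.toFinset.image φ,
      PGraph.weight (G.nbrIn (U \ Xf) v).card = PGraph.weight (G.nbrIn U v).card := by
    intro v hv
    obtain ⟨hv, hvY⟩ := Finset.mem_sdiff.1 hv
    obtain ⟨hvU, hvX⟩ := Finset.mem_sdiff.1 hv
    rw [hsub, Finset.sdiff_eq_self_of_disjoint]
    rw [Finset.disjoint_left]
    intro w _ hw
    obtain ⟨hw, hwX⟩ := Finset.mem_inter.1 hw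
    obtain ⟨x, hx, rfl⟩ := Finset.mem_image.1 hwX
    rw [List.mem_toFinset] at hx
    obtain ⟨j, hj, rfl⟩ := h.exists_of_full hs (hX x hx) hvU (mem_nbrIn.1 hw).2.symm
    have hjX : j ∉ X := fun hj' => hvX ((h.mem_image_iff hXl (hs.lt hj)).2 hj')
    exact hvY (Finset.mem_image_of_mem _ (List.mem_toFinset.2 ((hYmem j).2 ⟨hs.lt hj, hjX⟩)))
  have hcost : ∀ y ∈ Y, PGraph.weight (G.nbrIn (U \ Xf) (φ y)).card ≤
      PGraph.weight (G.nbrIn U (φ y)).card +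
        PGraph.cost (s.deg y) ((s.nbs y).countP (PGraph.memB · X)) := by
    intro y hy
    have hyl := hYl y hy
    have hint : G.nbrIn U (φ y) ∩ Xf =
        ((s.nbs y).filter (PGraph.memB · X)).toFinset.image φ := by
      ext w
      simp only [Finset.mem_inter, mem_nbrIn, Finset.mem_image, List.mem_toFinset,
        List.mem_filter, PGraph.memB_iff, hXf]
      constructor
      · rintro ⟨⟨-, hyw⟩, x, hx, rfl⟩
        obtain ⟨j, hj, hjy⟩ := h.exists_of_full hs (hX x hx) (h.mem hyl) hyw.symm
        have := h.inj (hs.lt hj) hyl hjy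
        subst this
        exact ⟨x, ⟨hs.symm hj, hx⟩, rfl⟩
      · rintro ⟨x, ⟨hx, hxX⟩, rfl⟩
        exact ⟨⟨h.mem (hXl x hxX), h.adj hyl hx⟩, x, hxX, rfl⟩
    have hcard : (G.nbrIn U (φ y) ∩ Xf).card = (s.nbs y).countP (PGraph.memB · X) := by
      rw [hint, Finset.card_image_of_injOn, List.toFinset_card_of_nodup,
        List.countP_eq_length_filter]
      · exact (hs.nodup y).filter _
      · exact h.injOn fun x hx => hs.lt (List.mem_of_mem_filter hx)
    rw [hsub, Finset.card_sdiff_of_subset Finset.inter_subset_left, hcard]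
    refine PGraph.weight_sub_le (hG.card_le _ (h.mem hyl)) ?_ ?_
    · by_cases hd : s.deg y = 0
      · exact Or.inl hd
      · exact Or.inr (h.deg hyl hd).symm
    · rw [← hcard]; exact Finset.card_le_card Finset.inter_subset_left
  have hXsum : ∑ v ∈ Xf, PGraph.weight (G.nbrIn U v).card =
      (X.map fun x => PGraph.weight (s.deg x)).sum := by
    rw [hXf, sum_toFinset_image hXn (h.injOn hXl)]
    congr 1
    exact List.map_congr_left fun x hx => by rw [(h.card_of_full (hX x hx)).1]
  have hUsplit : G.totalWeight U = ∑ v ∈ U \ Xf, PGraph.weight (G.nbrIn U v).card +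
      (X.map fun x => PGraph.weight (s.deg x)).sum := by
    rw [totalWeight, ← hXsum, Finset.sum_sdiff hXU]
  have hYle : ∑ v ∈ Y.toFinset.image φ, PGraph.weight (G.nbrIn (U \ Xf) v).card ≤
      ∑ v ∈ Y.toFinset.image φ, PGraph.weight (G.nbrIn U v).card +
        (Y.map fun y => PGraph.cost (s.deg y) ((s.nbs y).countP (PGraph.memB · X))).sum := by
    rw [sum_toFinset_image hYn (h.injOn hYl), sum_toFinset_image hYn (h.injOn hYl),
      ← List.sum_map_add]
    exact List.sum_le_sum hcost
  have hnew : G.totalWeight (U \ Xf) ≤ ∑ v ∈ U \ Xf, PGraph.weight (G.nbrIn U v).card +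
      (Y.map fun y => PGraph.cost (s.deg y) ((s.nbs y).countP (PGraph.memB · X))).sum := by
    rw [totalWeight, ← Finset.sum_sdiff hYU, ← Finset.sum_sdiff hYU, Finset.sum_congr rfl hrest]
    omega
  omega

theorem Realizes.not_reducible (h : G.Realizes U s φ) (hs : s.WF) (hG : G.MinCex U)
    {S : List ℕ} : s.reducible S = false := by
  by_contra hr
  simp only [PGraph.reducible, Bool.not_eq_false, Bool.and_eq_true, Bool.not_eq_true',
    List.isEmpty_eq_false_iff, PGraph.nodupB_iff, List.all_eq_true, PGraph.memB_eq_false,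
    Nat.ble_eq] at hr
  obtain ⟨⟨⟨⟨hne, hnd⟩, hind⟩, hfull⟩, hle⟩ := hr
  set X := s.nbhd S with hX
  have hXn : X.Nodup := PGraph.nodup_dedupB _
  have hXl : ∀ x ∈ X, x < s.length := fun x hx => PGraph.lt_of_full (hfull x hx)
  have hSX : ∀ x ∈ S, x ∈ X := fun x hx => PGraph.mem_nbhd.2 (Or.inl hx)
  have hlt := hG.totalWeight_lt (S := S.toFinset.image φ) (X := X.toFinset.image φ)
    ?_ ?_ ?_ ?_ ?_ ?_
  · rw [Finset.card_image_of_injOn (h.injOn fun x hx => hXl x (hSX x hx)),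
      List.toFinset_card_of_nodup hnd] at hlt
    have := h.totalWeight_sdiff_le hs hG.adm hfull hXn
    omega
  · obtain ⟨a, ha⟩ := List.exists_mem_of_ne_nil _ hne
    exact ⟨φ a, Finset.mem_image_of_mem _ (List.mem_toFinset.2 ha)⟩
  · intro v hv
    obtain ⟨a, ha, rfl⟩ := Finset.mem_image.1 hv
    exact Finset.mem_image_of_mem _ (List.mem_toFinset.2 (hSX a (List.mem_toFinset.1 ha)))
  · intro v hv
    obtain ⟨a, ha, rfl⟩ := Finset.mem_image.1 hv
    exact h.mem (hXl a (List.mem_toFinset.1 ha))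
  · intro a ha b hb hab
    obtain ⟨a, ha', rfl⟩ := Finset.mem_image.1 ha
    obtain ⟨b, hb', rfl⟩ := Finset.mem_image.1 hb
    replace ha := List.mem_toFinset.1 ha'
    replace hb := List.mem_toFinset.1 hb'
    have hbl := hXl b (hSX b hb)
    obtain ⟨j, hj, hjb⟩ := h.exists_of_full hs (hfull a (hSX a ha)) (h.mem hbl) hab
    exact hind a ha j hj (h.inj (hs.lt hj) hbl hjb ▸ hb)
  · intro v hv hvS
    obtain ⟨x, hx, rfl⟩ := Finset.mem_image.1 hv
    rcases PGraph.mem_nbhd.1 (List.mem_toFinset.1 hx) with hx | ⟨a, ha, hax⟩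
    · exact absurd (Finset.mem_image_of_mem _ (List.mem_toFinset.2 hx)) hvS
    · exact ⟨φ a, Finset.mem_image_of_mem _ (List.mem_toFinset.2 ha),
        (h.adj (hXl a (hSX a ha)) hax).symm⟩
  · intro v hv w hw hvw
    obtain ⟨a, ha, rfl⟩ := Finset.mem_image.1 hv
    rw [List.mem_toFinset] at ha
    obtain ⟨j, hj, rfl⟩ := h.exists_of_full hs (hfull a (hSX a ha)) hw hvw
    exact Finset.mem_image_of_mem _ (List.mem_toFinset.2 (PGraph.mem_nbhd.2 (Or.inr ⟨a, ha, hj⟩)))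

theorem Realizes.occurs_of_embeds (h : G.Realizes U s φ) {P : PGraph} {m : List ℕ}
    (hm : PGraph.embeds P s m = true) : G.Occurs U P := by
  simp only [PGraph.embeds, Bool.and_eq_true, Bool.or_eq_true, List.all_eq_true, Nat.blt_eq,
    Nat.beq_eq, PGraph.nodupB_iff, PGraph.memB_iff, List.mem_range] at hm
  obtain ⟨⟨⟨hlen, hnd⟩, hlt⟩, hP⟩ := hm
  have hget : ∀ {i}, i < P.length → m.getD i 0 ∈ m := fun {i} hi => by
    rw [List.getD_eq_getElem _ _ (hlen ▸ hi)]; exact List.getElem_mem _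
  refine ⟨fun i => φ (m.getD i 0), fun hi => h.mem (hlt _ (hget hi)), fun {i j} hi hj hij => ?_,
    fun {i j} hi hj => h.adj (hlt _ (hget hi)) ((hP i hi).2 j hj), fun {i} hi hd => ?_⟩
  · have := h.inj (hlt _ (hget hi)) (hlt _ (hget hj)) hij
    rw [List.getD_eq_getElem _ _ (hlen ▸ hi), List.getD_eq_getElem _ _ (hlen ▸ hj)] at this
    exact (hnd.getElem_inj_iff).1 this
  · rcases (hP i hi).1 with h0 | h0
    · exact absurd h0 hd
    · rw [h0] at hd ⊢
      exact h.deg (hlt _ (hget hi)) hd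

theorem MinCex.run_sound (hG : G.MinCex U) {known : List PGraph}
    (hk : ∀ P ∈ known, ¬ G.Occurs U P) :
    ∀ (f : ℕ) (ts : List ℕ) (st : List PGraph) (r : List ℕ), PGraph.run known f ts st = some r →
      (∀ s ∈ st, s.WF) → ∀ s ∈ st, ¬ G.Occurs U s := by
  intro f
  induction f with
  | zero =>
    intro ts st r hr hw s hs
    cases st with
    | nil => simp at hs
    | cons s' st => simp [PGraph.run] at hr
  | succ f ih =>
    intro ts st r hr hw
    cases st with
    | nil => simp
    | cons s st =>
      have hsw := hw s (by simp)
      have hw' : ∀ s' ∈ st, s'.WF := fun s' hs' => hw s' (by simp [hs'])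
      match ts with
      | [] => simp [PGraph.run] at hr
      | [0] => simp [PGraph.run] at hr
      | 0 :: v :: ts =>
        simp only [PGraph.run, Option.ite_none_right_eq_some] at hr
        obtain ⟨hv, hr⟩ := hr
        have := ih _ _ _ hr fun s' hs' => (List.mem_append.1 hs').elim (hsw.children hv) (hw' s')
        rw [List.forall_mem_cons]
        refine ⟨fun ⟨φ, hφ⟩ => ?_, fun s' hs' => this s' (by simp [hs'])⟩
        obtain ⟨c, hc, hoc⟩ := hφ.exists_child hsw hG.adm hv
        exact this c (by simp [hc]) hoc
      | (t + 1) :: ts =>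
        simp only [PGraph.run] at hr
        split_ifs at hr with h4 hred
        · rw [List.forall_mem_cons]
          refine ⟨fun ⟨φ, hφ⟩ => ?_, ih _ _ _ hr hw'⟩
          rw [hφ.not_reducible hsw hG] at hred
          exact absurd hred (by simp)
        · cases ts with
          | nil => simp at hr
          | cons i ts =>
            simp only at hr
            rcases hP : known[(t - 4) * 60 + i]? with _ | P
            · simp [hP] at hr
            · simp only [hP, Option.ite_none_right_eq_some] at hr
              rw [List.forall_mem_cons]
              exact ⟨fun ⟨φ, hφ⟩ => hk P (List.mem_of_getElem? hP) (hφ.occurs_of_embeds hr.1),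
                ih _ _ _ hr.2 hw'⟩

theorem MinCex.checkAll_sound (hG : G.MinCex U) :
    ∀ (f : ℕ) (known : List PGraph) (ts : List ℕ) (K : List PGraph),
      PGraph.checkAll f known ts = some K → (∀ P ∈ known, ¬ G.Occurs U P) →
      ∀ P ∈ K, ¬ G.Occurs U P := by
  intro f
  induction f with
  | zero =>
    intro known ts K hK hk
    cases ts with
    | nil => simp only [PGraph.checkAll, Option.some.injEq] at hK; exact hK ▸ hk
    | cons => simp [PGraph.checkAll] at hK
  | succ f ih =>
    intro known ts K hK hk
    cases ts with
    | nil => simp only [PGraph.checkAll, Option.some.injEq] at hK; exact hK ▸ hk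
    | cons t ts =>
      simp only [PGraph.checkAll] at hK
      split_ifs at hK with hwf
      split at hK
      · rename_i ts' hr
        refine ih _ _ _ hK ?_
        rw [List.forall_mem_cons]
        refine ⟨?_, hk⟩
        exact hG.run_sound hk _ _ _ _ hr (by simpa using PGraph.wf_sound hwf) _ (by simp)
      · simp at hK

theorem MinCex.not_occurs_of_checkCert (hG : G.MinCex U) {known goals : List PGraph}
    {cert : List ℕ} (hc : PGraph.checkCert known goals cert = true)
    (hk : ∀ P ∈ known, ¬ G.Occurs U P) : ∀ P ∈ goals, ¬ G.Occurs U P := by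
  intro P hP
  unfold PGraph.checkCert at hc
  split at hc
  · rename_i K hK
    have := List.all_eq_true.1 hc P hP
    exact hG.checkAll_sound _ _ _ _ hK hk P (by simpa using this)
  · simp at hc

end SimpleGraph

namespace SimpleGraph

open scoped Classical

variable {V : Type*} {G : SimpleGraph V} {U : Finset V}

theorem card_nbrIn_of_swap {G' : SimpleGraph V} {X : Finset V} (hXU : X ⊆ U) {a p q : V}
    (ha : a ∈ X) (hq : q ∈ U \ X) (hpq : ¬ G.Adj p q) (hX : ∀ x ∈ X, G.Adj p x ↔ x = a)
    (hG' : ∀ w, G'.Adj p w ↔ G.Adj p w ∨ w = q) :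
    (G'.nbrIn (U \ X) p).card = (G.nbrIn U p).card := by
  have haN : a ∈ G.nbrIn U p := mem_nbrIn.2 ⟨hXU ha, (hX a ha).2 rfl⟩
  have hset : G'.nbrIn (U \ X) p = insert q ((G.nbrIn U p).erase a) := by
    ext w
    simp only [mem_nbrIn, Finset.mem_insert, Finset.mem_erase, hG', Finset.mem_sdiff]
    constructor
    · rintro ⟨⟨hwU, hwX⟩, hw | hw⟩
      · exact Or.inr ⟨fun h => hwX (h ▸ ha), hwU, hw⟩
      · exact Or.inl hw
    · rintro (rfl | ⟨hwa, hwU, hw⟩)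
      · exact ⟨Finset.mem_sdiff.1 hq, Or.inr rfl⟩
      · exact ⟨⟨hwU, fun hwX => hwa ((hX w hwX).1 hw)⟩, Or.inl hw⟩
  rw [hset, Finset.card_insert_of_notMem, Finset.card_erase_of_mem haN]
  · have := Finset.card_pos.2 ⟨a, haN⟩
    omega
  · exact fun h => hpq (mem_nbrIn.1 (Finset.mem_of_mem_erase h)).2

/-- In a smallest counterexample, a gadget `X` of weight 28 that is joined to the rest by the
edges `ap` and `cq` cannot be replaced by the edge `pq`. -/
theorem MinCex.false_of_contract (hG : G.MinCex U) {X : Finset V} (hXU : X ⊆ U) {a c p q : V}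
    (ha : a ∈ X) (hc : c ∈ X) (hp : p ∈ U \ X) (hq : q ∈ U \ X) (hpq : p ≠ q)
    (hap : G.Adj a p) (hcq : G.Adj c q)
    (hout : ∀ x ∈ X, ∀ v ∈ U \ X, G.Adj x v → (x = a ∧ v = p) ∨ (x = c ∧ v = q))
    (hw : 28 ≤ ∑ x ∈ X, PGraph.weight (G.nbrIn U x).card)
    (hext : ∀ P Q : Prop, ¬ (P ∧ Q) → ∃ D ⊆ X, D.card ≤ 2 ∧ (∀ x ∈ D, ∀ y ∈ D, ¬ G.Adj x y) ∧
      (P → a ∉ D ∧ c ∈ D) ∧ (Q → c ∉ D ∧ a ∈ D) ∧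
      ∀ x ∈ X, x ∉ D → (x = a ∧ P) ∨ (x = c ∧ Q) ∨ ∃ d ∈ D, G.Adj x d)
    (hnadj : ¬ G.Adj p q)
    (hpath : ∀ s ∈ U \ X, ∀ t ∈ U \ X, G.Adj p s → G.Adj s t → ¬ G.Adj t q) : False := by
  set G' : SimpleGraph V := G ⊔ edge p q with hG'
  have hadj : ∀ x y, G'.Adj x y ↔ G.Adj x y ∨ (x = p ∧ y = q) ∨ (x = q ∧ y = p) := by
    intro x y
    rw [hG', sup_adj, edge_adj]
    constructor
    · rintro (h | ⟨h, -⟩)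
      · exact Or.inl h
      · exact Or.inr (by tauto)
    · rintro (h | ⟨rfl, rfl⟩ | ⟨rfl, rfl⟩)
      · exact Or.inl h
      · exact Or.inr ⟨by tauto, hpq⟩
      · exact Or.inr ⟨by tauto, hpq.symm⟩
  have hdeg : ∀ v ∈ U \ X, (G'.nbrIn (U \ X) v).card = (G.nbrIn U v).card := by
    intro v hv
    by_cases hvp : v = p
    · subst hvp
      refine card_nbrIn_of_swap hXU ha hq hnadj (fun x hx => ⟨fun h => ?_, ?_⟩) fun w => ?_
      · rcases hout x hx v hv h.symm with h' | h'
        · exact h'.1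
        · exact absurd h'.2 hpq
      · rintro rfl; exact hap.symm
      · rw [hadj]; simp [hpq]
    by_cases hvq : v = q
    · subst hvq
      refine card_nbrIn_of_swap hXU hc hp (fun h => hnadj h.symm)
        (fun x hx => ⟨fun h => ?_, ?_⟩) fun w => ?_
      · rcases hout x hx v hv h.symm with h' | h'
        · exact absurd h'.2 hpq.symm
        · exact h'.1
      · rintro rfl; exact hcq.symm
      · rw [hadj]; simp [hpq.symm]
    · congr 1
      ext w
      rw [mem_nbrIn, mem_nbrIn, hadj, Finset.mem_sdiff]
      simp only [hvp, hvq, false_and, or_false]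
      refine ⟨fun h => ⟨h.1.1, h.2⟩, fun h => ⟨⟨h.1, fun hwX => ?_⟩, h.2⟩⟩
      rcases hout w hwX v hv h.2.symm with h' | h'
      · exact hvp h'.2
      · exact hvq h'.2
  have hnew : ∀ {b d}, b ∈ U \ X → d ∈ U \ X → b ≠ p → d ≠ q → G'.Adj q b → G'.Adj b d →
      ¬ G'.Adj d p := by
    intro b d hb hd hbp hdq h1 h2 h3
    have h1' : G.Adj q b := by
      rcases (hadj _ _).1 h1 with h | h | h
      · exact h
      · exact absurd h.1.symm hpq
      · exact absurd h.2 hbp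
    have h3' : G.Adj d p := by
      rcases (hadj _ _).1 h3 with h | h | h
      · exact h
      · exact absurd h.2 hpq
      · exact absurd h.1 hdq
    rcases (hadj _ _).1 h2 with h | h | h
    · exact hpath d hd b hb h3'.symm h.symm h1'.symm
    · exact hbp h.1
    · exact G.irrefl (h.1 ▸ h1')
  have hnew' : ∀ {x y b d}, x ∈ U \ X → y ∈ U \ X → b ∈ U \ X → d ∈ U \ X → x ≠ b → y ≠ d →
      G'.Adj x y → G'.Adj y b → G'.Adj b d → G'.Adj d x → G.Adj x y := by
    intro x y b d _ _ hb hd hxb hyd h1 h2 h3 h4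
    rcases (hadj _ _).1 h1 with h | ⟨rfl, rfl⟩ | ⟨rfl, rfl⟩
    · exact h
    · exact absurd h4 (hnew hb hd hxb.symm hyd.symm h2 h3)
    · exact absurd h2.symm (hnew hd hb hyd.symm hxb.symm h4.symm h3.symm)
  have hadm : G'.Admissible (U \ X) := by
    refine ⟨fun v hv => (hdeg v hv).trans_le (hG.adm.card_le v (Finset.mem_sdiff.1 hv).1), ?_⟩
    intro x y b d hx hy hb hd h1 h2 h3 h4
    by_contra! hne
    obtain ⟨hxb, hyd⟩ := hne
    have hU : ∀ {v}, v ∈ U \ X → v ∈ U := fun h => (Finset.mem_sdiff.1 h).1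
    rcases hG.adm.eq_or_eq (hU hx) (hU hy) (hU hb) (hU hd)
      (hnew' hx hy hb hd hxb hyd h1 h2 h3 h4)
      (hnew' hy hb hd hx hyd hxb.symm h2 h3 h4 h1)
      (hnew' hb hd hx hy hxb.symm hyd.symm h3 h4 h1 h2)
      (hnew' hd hx hy hb hyd.symm hxb h4 h1 h2 h3) with h | h
    · exact hxb h
    · exact hyd h
  have hcard : (U \ X).card < U.card := by
    apply Finset.card_lt_card
    exact ⟨Finset.sdiff_subset, fun hss => (Finset.mem_sdiff.1 (hss (hXU ha))).2 ha⟩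
  obtain ⟨k, ⟨I, hIU, hI, hId, hIk⟩, hk⟩ := hG.bound G' (U \ X) hcard hadm
  have hPQ : ¬ (p ∈ I ∧ q ∈ I) := fun h => hI p h.1 q h.2 ((hadj _ _).2 (by tauto))
  obtain ⟨D, hDX, hD2, hD, hDP, hDQ, hDd⟩ := hext (p ∈ I) (q ∈ I) hPQ
  have hno : ∀ x ∈ D, ∀ y ∈ I, ¬ G.Adj x y := by
    intro x hx y hy h
    rcases hout x (hDX hx) y (hIU hy) h with ⟨rfl, rfl⟩ | ⟨rfl, rfl⟩
    · exact (hDP hy).1 hx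
    · exact (hDQ hy).1 hx
  refine hG.not_bound ⟨k + 2, ⟨I ∪ D, ?_, ?_, ?_, ?_⟩, ?_⟩
  · exact Finset.union_subset (hIU.trans Finset.sdiff_subset) (hDX.trans hXU)
  · intro x hx y hy h
    rcases Finset.mem_union.1 hx with hx | hx <;> rcases Finset.mem_union.1 hy with hy | hy
    · exact hI x hx y hy ((hadj _ _).2 (Or.inl h))
    · exact hno y hy x hx h.symm
    · exact hno x hx y hy h
    · exact hD x hx y hy h
  · intro v hv hvn
    rw [Finset.mem_union, not_or] at hvn
    by_cases hvX : v ∈ X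
    · rcases hDd v hvX hvn.2 with ⟨rfl, h⟩ | ⟨rfl, h⟩ | ⟨d, hd, h⟩
      · exact ⟨p, Finset.mem_union_left _ h, hap⟩
      · exact ⟨q, Finset.mem_union_left _ h, hcq⟩
      · exact ⟨d, Finset.mem_union_right _ hd, h⟩
    · obtain ⟨u, hu, hvu⟩ := hId v (Finset.mem_sdiff.2 ⟨hv, hvX⟩) hvn.1
      rcases (hadj _ _).1 hvu with h | ⟨rfl, rfl⟩ | ⟨rfl, rfl⟩
      · exact ⟨u, Finset.mem_union_left _ hu, h⟩
      · exact ⟨a, Finset.mem_union_right _ (hDQ hu).2, hap.symm⟩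
      · exact ⟨c, Finset.mem_union_right _ (hDP hu).2, hcq.symm⟩
  · exact (Finset.card_union_le _ _).trans (by omega)
  · have h1 : G.totalWeight U = ∑ v ∈ U \ X, PGraph.weight (G.nbrIn U v).card +
        ∑ x ∈ X, PGraph.weight (G.nbrIn U x).card := by
      rw [totalWeight, Finset.sum_sdiff hXU]
    have h2 : G'.totalWeight (U \ X) = ∑ v ∈ U \ X, PGraph.weight (G.nbrIn U v).card :=
      Finset.sum_congr rfl fun v hv => by rw [hdeg v hv]
    omega

/-- The same for a gadget given by a partial graph: the vertices below `k` form the gadget, and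
its two neighbours are `k` and `k + 1`. -/
theorem MinCex.adj_or_exists_path (hG : G.MinCex U) {B : PGraph} (hB : B.WF) {φ : ℕ → V}
    (h : G.Realizes U B φ) {k a c : ℕ} (hlen : B.length = k + 2) (ha : a < k) (hc : c < k)
    (hak : k ∈ B.nbs a) (hck : k + 1 ∈ B.nbs c) (hfull : ∀ i < k, B.full i = true)
    (hout : ∀ i < k, ∀ j ∈ B.nbs i, j < k ∨ (i = a ∧ j = k) ∨ (i = c ∧ j = k + 1))
    (hw : 28 ≤ ((List.range k).map fun i => PGraph.weight (B.deg i)).sum) {D₀ D₁ D₂ : List ℕ}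
    (hD : ∀ D ∈ [D₀, D₁, D₂], D.length ≤ 2 ∧ ∀ x ∈ D, x < k ∧ ∀ y ∈ B.nbs x, y ∉ D)
    (h₀ : ∀ x < k, x ∉ D₀ → ∃ y ∈ B.nbs x, y ∈ D₀)
    (h₁ : a ∉ D₁ ∧ c ∈ D₁ ∧ ∀ x < k, x ∉ D₁ → x = a ∨ ∃ y ∈ B.nbs x, y ∈ D₁)
    (h₂ : c ∉ D₂ ∧ a ∈ D₂ ∧ ∀ x < k, x ∉ D₂ → x = c ∨ ∃ y ∈ B.nbs x, y ∈ D₂) :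
    G.Adj (φ k) (φ (k + 1)) ∨ ∃ s ∈ U, ∃ t ∈ U, (∀ i < k, φ i ≠ s) ∧ (∀ i < k, φ i ≠ t) ∧
      G.Adj (φ k) s ∧ G.Adj s t ∧ G.Adj t (φ (k + 1)) := by
  by_contra hcon
  rw [not_or] at hcon
  have hkl : k < B.length := by omega
  have hkl' : k + 1 < B.length := by omega
  have hl : ∀ {i}, i < k → i < B.length := fun hi => by omega
  have hrange : ∀ x ∈ List.range k, x < B.length := fun x hx => hl (List.mem_range.1 hx)
  set X := (List.range k).toFinset.image φ with hX
  have hmem : ∀ {i}, i < B.length → (φ i ∈ X ↔ i < k) := fun hi => by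
    rw [h.mem_image_iff hrange hi, List.mem_range]
  have hXex : ∀ {v}, v ∈ X → ∃ i < k, φ i = v := fun hv => by
    obtain ⟨i, hi, rfl⟩ := Finset.mem_image.1 hv
    exact ⟨i, by simpa using hi, rfl⟩
  have hnot : ∀ {v}, v ∈ U \ X → ∀ i < k, φ i ≠ v := by
    rintro v hv i hi rfl
    exact (Finset.mem_sdiff.1 hv).2 ((hmem (hl hi)).2 hi)
  have hpX : φ k ∈ U \ X := Finset.mem_sdiff.2 ⟨h.mem hkl, fun h' => ((hmem hkl).1 h').false⟩
  have hqX : φ (k + 1) ∈ U \ X :=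
    Finset.mem_sdiff.2 ⟨h.mem hkl', fun h' => by have := (hmem hkl').1 h'; omega⟩
  have hDmem : ∀ D ∈ [D₀, D₁, D₂], ∀ {x}, x < k → (φ x ∈ D.toFinset.image φ ↔ x ∈ D) :=
    fun D hDD x hx => h.mem_image_iff (fun y hy => hl ((hD D hDD).2 y hy).1) (hl hx)
  have hDbase : ∀ D ∈ [D₀, D₁, D₂], D.toFinset.image φ ⊆ X ∧ (D.toFinset.image φ).card ≤ 2 ∧
      ∀ x ∈ D.toFinset.image φ, ∀ y ∈ D.toFinset.image φ, ¬ G.Adj x y := by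
    intro D hDD
    refine ⟨fun v hv => ?_, (Finset.card_image_le.trans (List.toFinset_card_le _)).trans
      (hD D hDD).1, fun v hv w hw hvw => ?_⟩
    · obtain ⟨i, hi, rfl⟩ := Finset.mem_image.1 hv
      have hik := ((hD D hDD).2 i (List.mem_toFinset.1 hi)).1
      exact (hmem (hl hik)).2 hik
    · obtain ⟨x, hx, rfl⟩ := Finset.mem_image.1 hv
      obtain ⟨y, hy, rfl⟩ := Finset.mem_image.1 hw
      rw [List.mem_toFinset] at hx hy
      have hxk := ((hD D hDD).2 x hx).1
      have hyk := ((hD D hDD).2 y hy).1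
      obtain ⟨j, hj, hjy⟩ := h.exists_of_full hB (hfull x hxk) (h.mem (hl hyk)) hvw
      rw [h.inj (hB.lt hj) (hl hyk) hjy] at hj
      exact ((hD D hDD).2 x hx).2 y hj hy
  have hlift : ∀ D ∈ [D₀, D₁, D₂], ∀ x < k, (∃ y ∈ B.nbs x, y ∈ D) →
      ∃ d ∈ D.toFinset.image φ, G.Adj (φ x) d := by
    rintro D - x hx ⟨y, hy, hyD⟩
    exact ⟨φ y, Finset.mem_image_of_mem _ (List.mem_toFinset.2 hyD), h.adj (hl hx) hy⟩
  refine hG.false_of_contract (X := X) (a := φ a) (c := φ c) (p := φ k) (q := φ (k + 1))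
    (fun v hv => ?_) ((hmem (hl ha)).2 ha) ((hmem (hl hc)).2 hc) hpX hqX
    (fun he => by have := h.inj hkl hkl' he; omega) (h.adj (hl ha) hak) (h.adj (hl hc) hck)
    ?_ ?_ ?_ hcon.1 fun s hs t ht h1 h2 h3 => hcon.2 ⟨s, (Finset.mem_sdiff.1 hs).1, t,
      (Finset.mem_sdiff.1 ht).1, hnot hs, hnot ht, h1, h2, h3⟩
  · obtain ⟨i, hi, rfl⟩ := hXex hv
    exact h.mem (hl hi)
  · intro x hx v hv hxv
    obtain ⟨i, hi, rfl⟩ := hXex hx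
    obtain ⟨j, hj, rfl⟩ := h.exists_of_full hB (hfull i hi) (Finset.mem_sdiff.1 hv).1 hxv
    rcases hout i hi j hj with h' | ⟨rfl, rfl⟩ | ⟨rfl, rfl⟩
    · exact absurd rfl (hnot hv j h')
    · exact Or.inl ⟨rfl, rfl⟩
    · exact Or.inr ⟨rfl, rfl⟩
  · rw [hX, sum_toFinset_image List.nodup_range (h.injOn hrange)]
    refine hw.trans (le_of_eq ?_)
    congr 1
    refine List.map_congr_left fun x hx => ?_
    rw [(h.card_of_full (hfull x (List.mem_range.1 hx))).1]
  · intro P Q hPQ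
    by_cases hP : P
    · obtain ⟨h1, h2, h3⟩ := hDbase D₁ (by simp)
      have hQ : ¬ Q := fun hQ => hPQ ⟨hP, hQ⟩
      refine ⟨_, h1, h2, h3, fun _ => ⟨?_, ?_⟩, fun hQ' => absurd hQ' hQ, fun v hv hvD => ?_⟩
      · rw [hDmem D₁ (by simp) ha]; exact h₁.1
      · rw [hDmem D₁ (by simp) hc]; exact h₁.2.1
      · obtain ⟨x, hx, rfl⟩ := hXex hv
        rw [hDmem D₁ (by simp) hx] at hvD
        rcases h₁.2.2 x hx hvD with rfl | h'
        · exact Or.inl ⟨rfl, hP⟩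
        · exact Or.inr (Or.inr (hlift D₁ (by simp) x hx h'))
    by_cases hQ : Q
    · obtain ⟨h1, h2, h3⟩ := hDbase D₂ (by simp)
      refine ⟨_, h1, h2, h3, fun hP' => absurd hP' hP, fun _ => ⟨?_, ?_⟩, fun v hv hvD => ?_⟩
      · rw [hDmem D₂ (by simp) hc]; exact h₂.1
      · rw [hDmem D₂ (by simp) ha]; exact h₂.2.1
      · obtain ⟨x, hx, rfl⟩ := hXex hv
        rw [hDmem D₂ (by simp) hx] at hvD
        rcases h₂.2.2 x hx hvD with rfl | h'
        · exact Or.inr (Or.inl ⟨rfl, hQ⟩)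
        · exact Or.inr (Or.inr (hlift D₂ (by simp) x hx h'))
    · obtain ⟨h1, h2, h3⟩ := hDbase D₀ (by simp)
      refine ⟨_, h1, h2, h3, fun hP' => absurd hP' hP, fun hQ' => absurd hQ' hQ,
        fun v hv hvD => ?_⟩
      obtain ⟨x, hx, rfl⟩ := hXex hv
      rw [hDmem D₀ (by simp) hx] at hvD
      exact Or.inr (Or.inr (hlift D₀ (by simp) x hx (h₀ x hx hvD)))

end SimpleGraph

namespace PGraph

/-- Two adjacent vertices of degree 1. -/
def leafEdge : PGraph := [(1, [1]), (1, [0])]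

/-- Adjacent vertices of degree 1 and 2. -/
def leafAtTwo : PGraph := [(1, [1]), (2, [0])]

/-- A vertex of degree 3 with two neighbours of degree 1. -/
def twoLeaves : PGraph := [(1, [1]), (3, [2, 0]), (1, [1])]

/-- A path of three vertices of degree 2. -/
def threeTwos : PGraph := [(2, [1]), (2, [2, 0]), (2, [1])]

/-- A triangle with a vertex of degree 2. -/
def triangleTwo : PGraph := [(2, [2, 1]), (0, [2, 0]), (0, [1, 0])]

/-- A bead whose two outer neighbours are adjacent. -/
def beadEdge : PGraph :=
  [(3, [5, 4, 1]), (2, [2, 0]), (3, [6, 3, 1]), (2, [4, 2]), (2, [3, 0]), (0, [6, 0]), (0, [5, 2])]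

/-- A bead whose two outer neighbours are joined by a path of length 3. -/
def beadPath : PGraph :=
  [(3, [5, 4, 1]), (2, [2, 0]), (3, [6, 3, 1]), (2, [4, 2]), (2, [3, 0]), (0, [7, 0]), (0, [8, 2]),
    (0, [8, 5]), (0, [7, 6])]

/-- A leaf pair in a triangle. -/
def leafPairTriangle : PGraph := [(1, [1]), (3, [4, 2, 0]), (3, [4, 3, 1]), (1, [2]), (0, [2, 1])]

/-- A leaf pair whose two outer neighbours are joined by a path of length 3. -/
def leafPairPath : PGraph :=
  [(1, [1]), (3, [4, 2, 0]), (3, [5, 3, 1]), (1, [2]), (0, [6, 1]), (0, [7, 2]), (0, [7, 4]),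
    (0, [6, 5])]

/-- A bead: a 5-cycle whose vertices have the degrees 3, 2, 3, 2, 2. -/
def bead : PGraph := [(3, [4, 1]), (2, [2, 0]), (3, [3, 1]), (2, [4, 2]), (2, [3, 0])]

/-- A leaf pair: two adjacent vertices of degree 3, each with a neighbour of degree 1. -/
def leafPair : PGraph := [(1, [1]), (3, [2, 0]), (3, [3, 1]), (1, [2])]

/-- A vertex of degree 1. -/
def degOne : PGraph := [(1, [])]

/-- A vertex of degree 2. -/
def degTwo : PGraph := [(2, [])]

/-- A vertex of degree 3. -/
def degThree : PGraph := [(3, [])]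

/-- A proof that some configurations do not occur. -/
def localCert : List ℕ := [
  25556719014017968700661191423580084884463820324992869976720436961354988525914860429657137225859,
  25566905234813476332024044092193979763146440845857840920250094007698640707780537782689960571075,
  8736911465211574694486332684732971566930294749110937648771348722457665499776805923789010641217,
  25558786922531646907518756815251320063455241948780964651660665650279978761707518349381003124868,
  76022376127480415457825059572997871729047375124785603631828089475581936583455015710946714210567,
  8747069292438528416608974155724035332019103769175683022715859936227110805579505252757403894407,
  33774376282376217210007276547466738088318303142233600084216635988535990072329217083441219403847,
  25293910538796785471791617353833665937926508191033719006899106620595843255032194701979415744707,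
  25687120157967502479563905277724650431358273362062626163402895520768108730119354037808024805700,
  75227803771286115505200836048256861190600256660436810731575959740455537856719389048581643329732,
  8612716487519969138360190461327976366582851505537233089117401960401935227473815242599389999489,
  16819998039877928022860035198653900263187323154518188022038029898052715732465203447853127831617,
  627184259331]

/-- A proof that vertices of positive degree do not occur. -/
def degreeCert : List ℕ := [
  33666158248688825938272066188203094008229938580858334817251662452845500580238189066732467667078,
  84227495884576851498543786283566541779653611800023632925417588754353421870093012542387691204868,
  16950622481827691122468457020910716061587966622282926233901582751487298358006537006009189155521,
  34811258514577153225279659325199826377013762909585970013284951006963313404245945719243479466115,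
  33900773556113473360538644204603021372358617740593438202972146677310296610554176880127699624324,
  83720176498350189476571259908425187272758747543320249606438786654867889155606556299211200803012,
  25560855841827343218507731044024028079380380613673821827153607756104500290275910230794830897606,
  41987768080258580092898017573926131261295489263478387252947286611597507993124883609933293826243,
  67285465656917270947309588115166423608855834889219079074336807750944196189089236033681405518089,
  17361978921283199378142958062240580386906907307823085740389078337451664668499703797607834358343,
  93102987456366199106787014707865715184368035785107494394668274648780867021545503963134571061635,
  51368255078238066724403302678085001908336812729593799890514434695234646466871419745835931672780,
  51498466679715486312591801040319779076659042656060889035247576085523997278205098122873299042568,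
  75620983551301628940132096912756257143532123710201219316852564190803290993334588075824596410568,
  109272756764596768318332141624994533042627207613499704199804497588989655344844441804120628404353,
  50329208029542352215375054956042636181349474993600913536500197187152122043863521414104761524875,
  42246153276416822126653252402727808445518882355058442307951339299034977548076208232010469110470,
  51113370951332888277588569688406842869008592837433446582976285160658698941455580473554916114886,
  50194637342177023594092930732009181700305818605602494236203914747978330899461326632002731647041,
  9790186434736413004062473464187898056185511950312207368459922123318625140827550884524876112001,
  8738924171324178580699719625271950724943421475053953910872598484771998808939421274672886997186,
  8478210414162606239437637974097887761774535411907818089446291468966380694719703924777079857539,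
  25448755151117239192105287665406120781520028939641519000572153599229217872579933421667582746689,
  100279276676996808543805925261689769357301683635217583742376294208958385690632777572210078396612,
  109808658786361291799486624503458008102445063286128275227044165988078680500958327544637134225476,
  26491980158782678975384447216398049427751205585525373616352860626619034652017069319407698972939,
  17473981615035986817403762787070694903558767180983270939356998462333083981270717087986221597314,
  17474078089295773318384877949900216867342706202272060279739416498735992921399134878406638342214,
  8739107691500080363629283884226296177961586615320199007264518354689325206956346469655924465798,
  58680930689209940455489139357585730013740861470639356563140441611105146577979915622201938161801,
  76150709393501834351958990201824998467658773952979844070520481579903619057450811743125236900035,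
  159326803710129631672769705765145441935155310650733463259961937176965705817668385360925528994570,
  51107325459100852881750488725453627899315459024331530246077770277591029145441557745553528611267,
  8742991762294503734484323297534363306849318489541548410095298013615364066414603361736265044485,
  9142379651464584423589489353137406956333908006246054830665131407276607525959703921030390640708,
  41893875356419472387829552338365372223738770624645040936940672006962146758194855050096642371713,
  25426410884366363358985478202728253948325645737210541504383804064130181778450673577409501024644,
  9533428393762881076354729067267027866104445567730851569934451482254523866758691098736649601223,
  109393320342283877649133690377269772635509448281235495018604596887690704275564673950632425341002,
  100267019648884360555440246699887385657448302409828769025135970570952112150959354334958094934913,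
  33509308546247155349022982711886581464600005255592668433902400673570092633638610936751967486470,
  42242079741365386848882083950448394005499239677794782776244762676277384464328108697322219643653,
  51628805161045576793415601881561534173869350839013738120883809099134885420575857856896147443788,
  8873424720103021365864093271779254406248459423319126824296813013542579767124408649815614317320,
  18254265852171240220134810381220991362584800260454718709044519579353701415845623895174574248641,
  25833883221309059860951822646458121462143143388118419691137780753245755367778883243469752012937,
  25949897814440828927122914539426673469716096934216137591489892978594905754601941154955833917506,
  17213082348407611985668833730429523951901298268246160397974342802257726617171000201242448253192,
  51378312926977872203973023669266662018558205764346314402252307518063823467087124047683969912900,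
  9144478806215667447193598806837076157102456722442163266425250088280113874194856963860727627843,
  50980963574013973657775309915513280199556261892007033340745292470590443237932893893707254739073,
  51107455757906087319237003779471676985116903429958345595225716830035139749187154665946000941441,
  8606668493264594331987529433609450121938903804830187379017419698518145065423576437130154221637,
  50468428718933992167997008900103133098734275853613389307434217520739028795257768693662842105988,
  8606607325181567895112093193122499257537402660747293242382580310969247397048669052599583904193,
  50589887976255248223874219250131401812529225127764342127831699538943694207635189965013991080327,
  8478176564857025106691531665187403498726279079067651535012449617672510928466919787784183750731,
  33770014789060874654546644311456332555221596190003127873912931602750870750307131894541389928198,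
  43556062894765953341990710345146320254528345786588586964706094368763726288273294746194776449350,
  16821875979780649461404478861782922696765770632693933748577403811903857552973925273499470143558,
  50716212530541874581896520569592876719589747170664350578164096272517136550759879135606482944257,
  51007575309330679074906733610597809485261558787898975427158893142939202826598363920958122889552,
  17341454414375978940997680855919869842823420900988899587575177358108997515476810109176594854147,
  50325069810541237137730037220326432531453100383737082695485052440661320179221268061191774949442,
  41857048578655806814346949327330737878291171871944278244440376093921250858866010557238900699268,
  50846646979957866719668982429678103321755333093359179217888397602757862936858775640448494490694,
  25560856759980897639255790242455925523519582778293366400864080847027551107749554094485539676562,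
  51759432129072043129358738268859543392987075804145265582652199061451876851770634108118331834564,
  93371748439792785512590417219491641398264807293090103100893237220297669714586369744798060405587,
  33790737230124712721851806022839114298015803861193794250764121990693818749003247262511743918913,
  8869353617271474109847033208151443054098529269652852022561281629109326611023581380754717556996,
  92703664709500079661720613396856798155785148173543101923992408951349663603593882001559991120264,
  9779938560554759531259179207688931113323103452253755370580926361756190586493443928367009894600,
  51378379086380690108343796632940528845038744642246009343516331650965391692339031785438622273602,
  51378379086390149859759599565291385635474882714910635878729181478858052235964760437433399255107,
  176024390157052111285723148584341540755834856856155648633841001230733036745434334684315998507075,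
  91931628610562273566940029512080260975887442893875661038914833120273945611320633783595397554572,
  16828084522990604156262166810471424507179714591061692587789454827042031574470960739816040609094,
  8618893840953322151837409739131919754403274157920407243916941090541708183084066751450392043846,
  84626848424934016248062505215131712373793317270082881437478772578860909225938494038309279924295,
  50196675870358372590403033543047424794749076545397130255267188981014378122861424374753575309574,
  51107263791136743277540953446860473836848218598011875048495496304285985665653757881773905162434,
  8755310498334590761812400595496165201007866390475613396867383855590829014329305825080856551489,
  41865198276699580072117841745836392371483450286278782405292742231983669981362593296473819984452,
  9659785802697327032955771001181438850620134143596132826728845357041666989196264990358704251329,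
  33780456571817477006755659493717030205246538980823571830827662243693828225443365656038965350795,
  42246153276413530858983891147288641429598689294356282105111437379662336358283376533387227447556,
  100925145919540859527964581372858871472638453891552552127379141064045707820147107911498481566150,
  59457204518716095295582709269428735481613517035744687141263954941300779933013258963189650452999,
  101701599888728000698279164007324148549086604167880693310441203304052420470348549083316554625347,
  36021355913785700500243437733607253648082767175991105566547936435224508926467510944221257798730,
  100925145919540859527964581372858871472638453517403784325354280532389791179715686942691902943619,
  10309538106337196250216738125881672181276655318449152959035388250340160607451191343567697637895,
  16820004566903866439165405125428903081464522639362831190398561016196381143479225979315560698253,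
  35744322392425985824360210115788544711962910326212989104197105220009684226454147497841210708227,
  85541700900134822170953163361317783813686718784690173942174173590443599123736368539543464882563,
  126469827292993957707102070215658649708886478131062490544022878101080607716718844407499816231628,
  10701035442447314869703132700268069181925390167216465432186307247542552208996583013281330389953,
  16820002072014620402354889507666075053627122886546980961454620193513324964591401635154811216273,
  51241837508008694478624786555639449896091111803616539889124108931919165090534934330991906935043,
  93102987456366199106787096611561796139786124809784660186865653332272250161666956557654077526274,
  52541846455915445641387359573206013050840086744335266003248956356908510064796519159126405473100,
  59982850918455210995613321362024610500427677601856856928078092178448970533966471584924994921693,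
  75888220301439503585984558677046049385667547621518017166519242450163975859899380685644140962248,
  110053290703416161280059280036840074931969130343631301307694530045315569557053212853544217256710,
  43030545908580515986502428350671746940216019005470600941130270216089897882579765073072386741188,
  25165583761040852225415610779095551575007497794118472023292109860055657790329282770217898926531,
  134962293943477365237893116527544298181341105652544161261783557661771662796187793676693751210242,
  52280950179915489879572317330120784895833825767321739389669741370758345050512906263697910416385,
  27392183939786000140469179673930295134115721230313594091025681604694770190641115164825593619280,
  118272671640570789477890615043222849009403677664525058073036912018730815508716814663389990109444,
  143306025138999472018269703222094535650978436806131777035603138904719798968157859219005480690701,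
  160771222953784380640886623352428902792967734358642790851305284638831380691881567175255311803521,
  52604617484099746707069492413529638052221941715311078069357511032670768566883418829147537937153,
  267815272443878710667347487014045552693192187162567000078516364693270640297184726141371832636369,
  84115459388022516349081605871494589348690483596171881050668117058433614194622201273814686962065,
  141999937939633094803119293815942094266716127508066794129927695710660791213124535157897036063685,
  17500214957882535584400344317430496272976729710920399472773214366710327826853608805278704539718,
  51889966588306352964433302013768844258358083383855004231443834834103164737889921436133796405515,
  51629130977838009454905028667873588178697354954360264303212326347750552393214532657291465122516,
  33904556119669362007506193298014480759514206012644766149344461697749840728425499171797808472865,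
  51889964598772442135703958625397437554868054307652479336306130208682806730478102247360135180484,
  176036615365377172032313889030649833821677354552881216593634670711998349515952063736721990267795,
  159352298627818337230767498217347550832585826496585766001188085796726866623757548099089077900424,
  16856505038072348494920330660562915377303248550163765490473047763824585869392517892217412596365,
  84622709716259102387391384256539574234999392475692683231793024610705236573475763653701266317505,
  125314764136378052769714585349737527982688389368246193345887990576825427404427606648705468920331,
  133660662690496597168160495351108117707402426333551697065266041478247762185995921410038174340358,
  10191994313603780981458704895236913250589158350122859131495558189305005401080158113665482557638,
  109012111093476179641007529801454180239910956660753919917761973608834768910777238550007512969615,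
  94791878315086258687235523446501449964705483299800924124623937311071562048055122365757286797957,
  118292914126271276570381169984019429423508282227442367690707191091480331633763619920444968415630,
  52020202092988637368098029509663778358561109293055559231943678357236737684826684827652009780161,
  25293942469627853987452012447485835950269443315201398063959400059126344345337918899340351152469,
  8741018384058458206693818229997120740192522432319629431610394175838626794333986198863566627140,
  100271385314845583109429666464528875430095552254731810821900324150612244834442095435982121746497,
  143953453972041233665761655115389266115154947649688407626214221487279618688067766072958123271558,
  27583704586652291896727131028938015313305914059469615990486626817751949128751208325414202401921,
  51702207065093252462678131279442881794615395548946725158667067399262073753433404145779566470146,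
  8873361047064095774119642402159490283528037868030072385264868406850349184839031950473652375958,
  51834614899893654009903508907897278360307925435128710968797504262516447373547439616666704024833,
  77095900032450318842200705785692423417327867422028081852790638486426263366047103165007178019095,
  92569162226355914405209041647109816024203425103846225893737532889759553074387094792770395914641,
  58807515903876715285107074442906322746671897172613325161782285329714384831090334041437939492294,
  192727223378831135264922773990089595124246698743869574389199201419450943079229884531389359199246,
  59463502184058155420905294879074942791799009576726554929839776158074736360238211011391620461200,
  77843712077142819126935727000383412537780984509164956837641130359564339012770797634387421229646,
  135338731283661293144154348287445542608783773494597450152056622638107191727257748370244207182598,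
  77843645922977974522436256743371098590787291399849526700753874530525628903146058083989146329921,
  33770014790282897650619188295742485178305087101273249819651130822280507412494177024980361478918,
  125827877899245014622594743217596665591543569201337415632200314158168773968323744247316079473029,
  51629218507706394248358894318026388220254885149885670790262543439287285285137896897913627370054,
  143546209798615487580378023125666665975076124241968797759813113722144404683701481943520689295769,
  77360711288675576993440189755048925306191733711591778804049819388074574199309024130405917851726,
  16856505061748536690596869453555772064894439199391512640351566692623339629543879423491481063506,
  150995592177233301609681478584683224043007131251141842452567030995478696290356416901123316654273,
  9938859219336021891552778606081979519100244832937984801120349172187184751782074614442598867337,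
  342912640074024124991219717514208774732228571355438619603546578441713996073308266864582971203981,
  10953174801967034523623123906586080355534068141151316555215706788141318427190662434556078510163,
  126221183011633125755176247847148692385909978969336700463637444379565728567963848171718445641794,
  10579253978184059115017232771302248906626594261961949180647196586232608913062244180996653110030,
  50460031963193610639044106187653431291090005914267350972665928334978466612248572649450936902034,
  92316531408224589007305477320246246379835448273478111647928658981567388419700835406590308279489,
  92359408613215177183547935191439645406728223706907809478468171929024130366804565186239886021444,
  51759562941855755396575507835824702214124218255208685455232193186818027850319848850447090913677,
  51759562941855755396575507835824702214124219802305498468197135861462842562636352548984541430489,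
  251121762205969897704710706753270695518019013686414732784867661864419365638204172588899582100185,
  16854468025407951787218276807069963579211668122964172353593391597661280824249862316899571610507,
  9008287561228650041918256069441171080384362080336223927960694984673789386259435693114848714945,
  120605012227234569263996855592003932995770999179485046728896798095169892475948591539222585032898,
  25293910626112665041366695425870003478907679601078309663989799692439768220305660847839999713867,
  133658627138857785916006104948197907658793196839370335250583123936925594410196530070182287925572,
  51629271667599898180047106175888362716013430214224843274430003807947257919388047731020105583366,
  50331150060632362638995689069872696952987795025538658797197429723794837518732488854635633992492,
  33648056212642177908920006380843299346963335937276641290959689399396800501877961626065944981827,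
  42246153315281623549488141730683379051471362266336397718440826985797468072747307682274838320077,
  118406954523622464593955629107870490519430536700202472266378841632527356890186051667931364098502,
  116975238400360745383428592158242070091455925292945810426813776428706409948745309677950175568897,
  16822040143192309093057025361789038432094800021391421488831430790646440857221402836398030984129,
  16820005593832156656122935125897649754377256992772730402080645190932917423482885227128796238083,
  52028256746572033409611364101123825585476435513257543954624267801168737752325810638911585145091,
  85195153084807009080671136372519645244778113400504715212594603508760881128538683512811601838473,
  110055265519230564839955554280177712744233435645316375305168619126337171486542931545826047361417,
  118531404550662747706602054228847885588800331477974727140130346496975745253612525369909527471054,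
  52038295660429520037072602047105761857197919345772082399567503193153193557499927699027005543439,
  58807290086831990004403766733662891186952241189837813812114903324140414629713124444237078470721,
  52411344835561479547988587640949897275184126262747299970841774421259588380036708805551393620676,
  152038387177086052309546227070207489370787215184738888404498678048403419609647373747127159121071,
  158701559016263045957728952827912654253792357655734633055877047872268755382197974341828520207233,
  51282582194207690628053976977812482022644127149389560648591383913202220662279925483478367418502,
  85718674671405783895580284553541223445502242940164317185856247739223293283691349866429539497228,
  43421811031165840353668510351778368323106228571007413164694580495873481681664882119376186732627,
  101837863385339927438678238121425282034433131847807753734178719906705981904972406455735298879818,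
  43711019406901303778021436665760125282710929757510261897358267051289998378331220558887215764430,
  51296835971475886357395455245363862135491487906309805555655289285251381042989029901207569248332,
  146157928138694879628353295720650184949668511149228741479008496319337620695114695460949735064524,
  11049084064453589394604076971851972158776986573864685064249935279968860729858615237042891932810,
  52560159809663834466356370053853609044872974885521818824326632140548738591060137632273545662863,
  186340516802120210639777340831747901154243694995741188353619412712013841692448856706038600848030,
  43032800848268126864732167790366168098936111722725698091503758660603392010592822458230869632902,
  35104574732403118778491955654726158960984795266063966710164875322195467769280266508068170797455,
  143959533802999293151819323080569170459707804343237358351747340934183487479579865452189606010958,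
  42124133070635748874465337751248568576615738554382286861253633241772167756446784625298830067718,
  259475932635844378293835416064236386795150215625150450302995834726959782098162494965168321094415,
  17213049999109967138907395064878514846704236957961030094180408313869503600361447885759336726921,
  51889966066692757404691140103194912720004927003622608088141281190599811318040914314145265635526,
  59514241028978596677552859832503292092724893264892245352382119506129094272468886139864207622627,
  10725520134775174591314154794143269107121452930319495823761852405091005553783695222498712421198,
  25430486464177246755271026609187520285803063107583613338534073526420551682304970716636401836434,
  25960880786301905517606576475012023760592228064408956668482936009753762752986098186922847375555,
  67735718229587989125453109270818712225099720230608233672754572773973118069607145893168638354373,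
  87751595951405412765338671477715767963206581543614853387553026315957313986830565717171736809870,
  301181469513396580774244702226740057680796785717106721924991145330695927572567009586619304977349,
  52028256746572033409611364101123825585672596065010124550045758451298395259069348973019193459270,
  25293942492848819847152465877165386347950474204042135072896081460206620887478138368312504795529,
  59194292638382489010199080272183688890381691512761322427365953359007032250985366862773102600516,
  126879049866323670028665611294556828510031545320050062008922394441208302383831219323162824843588,
  93102987456366199106787320581411520449899171569378792883750986129826210376203294921584929432577,
  59463502184058155420905294879074942791799009576723699372777367128971968530189248255741476528972,
  55028872401124008322591593151270393048734060288528082195666666786645135285966379149529099600590,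
  117870225281626885869685244809959669832518733405157230963770347426549184431988821350766763578121,
  46424499007484390241942811974610155052814909005614199447881780558149325471970125822599342875649,
  84166450911662773098263692750810834964666575438231804355379032043523226098165103498240063988682,
  59510167010367572611939185547370142989729170016305136415269433142975524465620293456744859369551,
  140421547867607789842298881229381664903773230104835869690336673478045219280057082254041263173955,
  51995541240642761013390120793159261594442355167470278418177867980824140362456622391662942927366,
  25689252695654716089644924923912740911600900908214347182846011506535009163424297314428523151846,
  59198367666354249899569238579806077035324483852374572778522873369797905654487871191795266269447,
  9926686728490266102955502724894455689270027547853649966433773284447497108050886655605234500292,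
  52281043381532426499077911746221264362793935631840582724946181087272303702568205445301765304718,
  67935374639959904925287817107350105344789268561466504980716753705181363371924370550211038680182,
  451372579633538198638362917522654257583976583439751318788357101373654708410750163236164055392907,
  135218901234071786113293098893527810504475271737930226653041269662122686377361528240056678379919,
  51903918921845355517360793608928210284203596001869762935570645031763343458967833510259632902662,
  8476140026327271050403845345431047287783910413644825099563329535457213781086094123523199737922,
  84639070640792023222479698407809192686485515946108923794970438008488732420474530722557756448847,
  9417637146600498601496137618987307913335926422610782459118386374377846072129506137407586620171,
  42246153338583890262840245946337949581636212562607556941098820169233792777421734225696672674189,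
  118331617388630524604366822986833306663798942438625616080593023797349806780397485761855517680070,
  33904556119434148895841244133056721229503338450065123684601929754303401169096235884045884242566,
  72368090792658398192871172229478179440182313850510126396903793490672155226296785434061985558596,
  42515106684477213467703658540458063204314419049206671849287812677470015924404274351911842787723,
  50457417983457973930698548879956659290749714750025680527771603336388676690333799845719733731914,
  80711764798565669045840700528870540054948666702621571683979899749911920764658968741650257170695,
  127007543582094930573248960112321382166472031752547732666881914996601355740383551080709695782991,
  276138720862900798434215419131779844076194571234810298016678151110566450138923998575975187103950,
  38862986720998065816616663032769248662515586398088049896920337721912871676629839563530082476161,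
  55550353540152289878817540148114604857265344531480527682598217136564827432506067660774760538955,
  108623196171305059443752567546960580310275075125000845537784420636220717716155737680344631763721,
  50463781699583367975075820364843763599816204308631950434767243859640632778940337535931124080198,
  33904555683906254310042688409425935473829549176912555268935097951439675637042989205244452282463,
  67275198939697282840992992316827043119434253636709217553385101723210949651904339401155031601412,
  284484329686752898309133873063576978322288927315780602150512131475008021608551732922881646026951,
  33525827556375395234284928079547406777348776844787648926372189270565631598192786511006248493185,
  51237663963615162951077089766569762170706620562822082193030828717022197812909471194349488838854,
  16827986558083800586718109874898415478815545960349463679971514627343075531054067975823164727930,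
  8694262517034011949542167536149077067513101552037415308881236070714856017727102054428214042817,
  66886302083423424865593417540529659183292492410919117042346927202884984497420600184007205208452,
  75879638405811597560096876828731658415320123245880745563085774146252604820460307906769866725574,
  25295247359070518305552471376580620941300995451539462096011886049404985155491900531083552514245,
  41859087129312126591537201955795605007999265660481441201570607232823092308262757216135223447622,
  66894479600419780207403542118399753385054143525596837990525155206339779233809742229031028538118,
  58799108155786563885640513059538819371001054806202439803120078911436391685666967943208741669574,
  4666296637168574658]

theorem checkCert_localCert : checkCert [] [leafEdge, leafAtTwo, twoLeaves, threeTwos, triangleTwo,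
    beadEdge, beadPath, leafPairTriangle, leafPairPath] localCert = true := by
  decide +kernel

theorem checkCert_degreeCert : checkCert
    [leafPair, bead, triangleTwo, threeTwos, twoLeaves, leafAtTwo, leafEdge]
    [degOne, degTwo, degThree] degreeCert = true := by
  decide +kernel

end PGraph

namespace PGraph

/-- A bead with its outer neighbours. -/
def beadOuter : PGraph :=
  [(3, [5, 4, 1]), (2, [2, 0]), (3, [6, 3, 1]), (2, [4, 2]), (2, [3, 0]), (0, [0]), (0, [2])]

/-- A leaf pair with its outer neighbours. -/
def leafPairOuter : PGraph :=
  [(1, [1]), (3, [4, 2, 0]), (3, [5, 3, 1]), (1, [2]), (0, [1]), (0, [2])]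

end PGraph

namespace SimpleGraph

open PGraph

variable {V : Type*} {G : SimpleGraph V} {U : Finset V} {φ : ℕ → V}

theorem Realizes.extend {B T : PGraph} (h : G.Realizes U B φ) (hB : B.WF) {ψ : ℕ → V}
    (hψ : ∀ i < B.length, ψ i = φ i)
    (hnew : ∀ i < T.length, B.length ≤ i → ψ i ∈ U ∧ ∀ j < i, ψ j ≠ ψ i)
    (hadj : ∀ i < T.length, ∀ j ∈ T.nbs i, i < B.length ∧ j ∈ B.nbs i ∨ G.Adj (ψ i) (ψ j))
    (hdeg : ∀ i < T.length, T.deg i ≠ 0 → i < B.length ∧ B.deg i = T.deg i) :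
    G.Realizes U T ψ where
  mem {i} hi := by
    by_cases hiB : i < B.length
    · rw [hψ i hiB]; exact h.mem hiB
    · exact (hnew i hi (not_lt.1 hiB)).1
  inj {i j} hi hj hij := by
    have key : ∀ {a b}, b < T.length → ψ a = ψ b → ¬ a < b := fun {a b} hb hab hlt => by
      by_cases hbB : b < B.length
      · rw [hψ a (hlt.trans hbB), hψ b hbB] at hab
        exact hlt.ne (h.inj (hlt.trans hbB) hbB hab)
      · exact (hnew b hb (not_lt.1 hbB)).2 a hlt hab
    exact le_antisymm (not_lt.1 (key hi hij.symm)) (not_lt.1 (key hj hij))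
  adj {i j} hi hj := by
    rcases hadj i hi j hj with ⟨hiB, hjB⟩ | h'
    · rw [hψ i hiB, hψ j (hB.lt hjB)]; exact h.adj hiB hjB
    · exact h'
  deg {i} hi hd := by
    obtain ⟨hiB, hd'⟩ := hdeg i hi hd
    rw [hψ i hiB, ← hd']
    exact h.deg hiB (hd' ▸ hd)

/-- Adds a path of length 3 between the vertices `k` and `k + 1`. -/
theorem Realizes.occurs_of_path {B T : PGraph} (h : G.Realizes U B φ) (hB : B.WF) {k : ℕ}
    (hlen : B.length = k + 2) (hnadj : ¬ G.Adj (φ k) (φ (k + 1))) {s t : V} (hs : s ∈ U)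
    (ht : t ∈ U) (hsk : ∀ i < k, φ i ≠ s) (htk : ∀ i < k, φ i ≠ t) (h1 : G.Adj (φ k) s)
    (h2 : G.Adj s t) (h3 : G.Adj t (φ (k + 1))) (hT : T.length = k + 4)
    (hadj : ∀ i < T.length, ∀ j ∈ T.nbs i, i < B.length ∧ j ∈ B.nbs i ∨
      (i, j) ∈ [(k, k + 2), (k + 2, k), (k + 2, k + 3), (k + 3, k + 2), (k + 3, k + 1),
        (k + 1, k + 3)])
    (hdeg : ∀ i < T.length, T.deg i ≠ 0 → i < B.length ∧ B.deg i = T.deg i) :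
    G.Occurs U T := by
  set ψ : ℕ → V := Function.update (Function.update φ (k + 2) s) (k + 3) t with hψ
  have hφ : ∀ {i}, i < k + 2 → ψ i = φ i := fun {i} hi => by
    rw [hψ, Function.update_of_ne (by omega), Function.update_of_ne (by omega)]
  have hψs : ψ (k + 2) = s := by
    rw [hψ, Function.update_of_ne (by omega), Function.update_self]
  have hψt : ψ (k + 3) = t := by rw [hψ, Function.update_self]
  have hout : ∀ {v}, (∀ i < k, φ i ≠ v) → φ k ≠ v → φ (k + 1) ≠ v → ∀ j < k + 2, ψ j ≠ v := by
    intro v h1 h2 h3 j hj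
    rw [hφ hj]
    obtain hj | rfl | rfl : j < k ∨ j = k ∨ j = k + 1 := by omega
    exacts [h1 j hj, h2, h3]
  have hs' := hout hsk h1.ne (fun he => hnadj (he ▸ h1))
  have ht' := hout htk (fun he => hnadj (he ▸ h3)) h3.ne'
  refine ⟨ψ, h.extend hB (fun i hi => hφ (by omega)) (fun i hi hiB => ?_)
    (fun i hi j hj => ?_) hdeg⟩
  · obtain rfl | rfl : i = k + 2 ∨ i = k + 3 := by omega
    · rw [hψs]; exact ⟨hs, hs'⟩
    · rw [hψt]
      refine ⟨ht, fun j hj => ?_⟩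
      obtain hj | rfl : j < k + 2 ∨ j = k + 2 := by omega
      · exact ht' j hj
      · rw [hψs]; exact h2.ne
  · refine (hadj i hi j hj).imp id fun hij => ?_
    have hk := hφ (show k < k + 2 by omega)
    have hk' := hφ (show k + 1 < k + 2 by omega)
    simp only [List.mem_cons, Prod.mk.injEq, List.not_mem_nil, or_false] at hij
    rcases hij with ⟨rfl, rfl⟩ | ⟨rfl, rfl⟩ | ⟨rfl, rfl⟩ | ⟨rfl, rfl⟩ | ⟨rfl, rfl⟩ | ⟨rfl, rfl⟩
    · rw [hk, hψs]; exact h1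
    · rw [hk, hψs]; exact h1.symm
    · rw [hψs, hψt]; exact h2
    · rw [hψs, hψt]; exact h2.symm
    · rw [hk', hψt]; exact h3
    · rw [hk', hψt]; exact h3.symm

theorem MinCex.not_occurs_local (hG : G.MinCex U) : ∀ P ∈ [leafEdge, leafAtTwo, twoLeaves,
    threeTwos, triangleTwo, beadEdge, beadPath, leafPairTriangle, leafPairPath],
    ¬ G.Occurs U P :=
  hG.not_occurs_of_checkCert checkCert_localCert (by simp)

theorem MinCex.not_occurs_bead (hG : G.MinCex U) : ¬ G.Occurs U bead := by
  rintro ⟨φ, h⟩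
  have hB : bead.WF := wf_sound (by decide)
  obtain ⟨c, hc, φ, h⟩ := h.exists_child hB hG.adm (v := 0) (by decide)
  have hcB := hB.children (by decide) hc
  rw [show bead.children 0 = [[(3, [5, 4, 1]), (2, [2, 0]), (3, [3, 1]), (2, [4, 2]), (2, [3, 0]),
    (0, [0])]] by decide, List.mem_singleton] at hc
  subst hc
  obtain ⟨c, hc, φ, h⟩ := h.exists_child hcB hG.adm (v := 2) (by decide)
  rw [show PGraph.children _ 2 = [beadOuter] by decide, List.mem_singleton] at hc
  subst hc
  have hB : beadOuter.WF := wf_sound (by decide)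
  have hnadj : ¬ G.Adj (φ 5) (φ 6) := fun hadj => by
    refine hG.not_occurs_local beadEdge (by simp) ⟨φ, h.extend hB (fun _ _ => rfl)
      (fun i hi hi' => absurd hi (not_lt.2 hi')) (fun i hi j hj => ?_) (by decide)⟩
    have : ∀ i < beadEdge.length, ∀ j ∈ beadEdge.nbs i, i < beadOuter.length ∧
      j ∈ beadOuter.nbs i ∨ (i = 5 ∧ j = 6) ∨ (i = 6 ∧ j = 5) := by decide
    refine (this i hi j hj).imp id ?_
    rintro (⟨rfl, rfl⟩ | ⟨rfl, rfl⟩)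
    exacts [hadj, hadj.symm]
  rcases hG.adj_or_exists_path hB h (k := 5) (a := 0) (c := 2) (D₀ := [0, 2]) (D₁ := [2, 4])
    (D₂ := [0, 3]) rfl (by decide) (by decide) (by decide) (by decide) (by decide) (by decide)
    (by decide) (by decide) (by decide) (by decide) (by decide) with
    hadj | ⟨s, hs, t, ht, hs', ht', h1, h2, h3⟩
  · exact hnadj hadj
  · exact hG.not_occurs_local beadPath (by simp)
      (h.occurs_of_path hB rfl hnadj hs ht hs' ht' h1 h2 h3 rfl (by decide) (by decide))

theorem MinCex.not_occurs_leafPair (hG : G.MinCex U) : ¬ G.Occurs U leafPair := by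
  rintro ⟨φ, h⟩
  have hB : leafPair.WF := wf_sound (by decide)
  obtain ⟨c, hc, φ, h⟩ := h.exists_child hB hG.adm (v := 1) (by decide)
  have hcB := hB.children (by decide) hc
  rw [show leafPair.children 1 = [[(1, [1]), (3, [4, 2, 0]), (3, [3, 1]), (1, [2]), (0, [1])]]
    by decide, List.mem_singleton] at hc
  subst hc
  obtain ⟨c, hc, φ, h⟩ := h.exists_child hcB hG.adm (v := 2) (by decide)
  rw [show PGraph.children _ 2 = [leafPairTriangle, leafPairOuter] by decide, List.mem_cons,
    List.mem_singleton] at hc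
  rcases hc with rfl | rfl
  · exact hG.not_occurs_local leafPairTriangle (by simp) ⟨φ, h⟩
  have hB : leafPairOuter.WF := wf_sound (by decide)
  have hlt : ∀ {i}, i < 6 → i < leafPairOuter.length := id
  have hnadj : ¬ G.Adj (φ 4) (φ 5) := fun hadj => by
    rcases hG.adm.eq_or_eq (h.mem (hlt (by decide : 1 < 6))) (h.mem (hlt (by decide : 2 < 6)))
      (h.mem (hlt (by decide : 5 < 6))) (h.mem (hlt (by decide : 4 < 6)))
      (h.adj (by decide) (by decide)) (h.adj (by decide) (by decide)) hadj.symm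
      (h.adj (by decide) (by decide)) with he | he
    · exact absurd (h.inj (by decide) (by decide) he) (by decide)
    · exact absurd (h.inj (by decide) (by decide) he) (by decide)
  rcases hG.adj_or_exists_path hB h (k := 4) (a := 1) (c := 2) (D₀ := [1, 3]) (D₁ := [0, 2])
    (D₂ := [1, 3]) rfl (by decide) (by decide) (by decide) (by decide) (by decide) (by decide)
    (by decide) (by decide) (by decide) (by decide) (by decide) with
    hadj | ⟨s, hs, t, ht, hs', ht', h1, h2, h3⟩
  · exact hnadj hadj
  · exact hG.not_occurs_local leafPairPath (by simp)
      (h.occurs_of_path hB rfl hnadj hs ht hs' ht' h1 h2 h3 rfl (by decide) (by decide))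

theorem MinCex.not_occurs_vertex (hG : G.MinCex U) :
    ∀ P ∈ [degOne, degTwo, degThree], ¬ G.Occurs U P := by
  refine hG.not_occurs_of_checkCert checkCert_degreeCert fun P hP => ?_
  simp only [List.mem_cons, List.not_mem_nil, or_false] at hP
  rcases hP with rfl | rfl | rfl | rfl | rfl | rfl | rfl
  · exact hG.not_occurs_leafPair
  · exact hG.not_occurs_bead
  all_goals exact hG.not_occurs_local _ (by simp)

theorem not_minCex : ¬ G.MinCex U := by
  intro hG
  have hne : U.Nonempty := by
    rw [Finset.nonempty_iff_ne_empty]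
    rintro rfl
    exact hG.not_bound ⟨0, ⟨∅, by simp⟩, by simp⟩
  obtain ⟨v, hv⟩ := hne
  have key : ∀ d, d ≠ 0 → (G.nbrIn U v).card = d → G.Occurs U [(d, [])] := fun d _ hd => by
    refine ⟨fun _ => v, fun _ => hv, fun {i j} hi hj _ => ?_, fun {i j} hi hj => ?_,
      fun {i} hi _ => ?_⟩
    · simp only [List.length_singleton] at hi hj; omega
    · obtain rfl : i = 0 := by simpa using hi
      simp [nbs] at hj
    · obtain rfl : i = 0 := by simpa using hi
      exact hd
  have h3 := hG.adm.card_le v hv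
  obtain hd | hd | hd | hd : (G.nbrIn U v).card = 0 ∨ (G.nbrIn U v).card = 1 ∨
    (G.nbrIn U v).card = 2 ∨ (G.nbrIn U v).card = 3 := by omega
  · have hno : ∀ w ∈ U, ¬ G.Adj v w := fun w hw hvw =>
      Finset.notMem_empty w (Finset.card_eq_zero.1 hd ▸ mem_nbrIn.2 ⟨hw, hvw⟩)
    classical
    have h1 := hG.totalWeight_lt (Finset.singleton_nonempty v) subset_rfl
      (Finset.singleton_subset_iff.2 hv) (by simp) (fun x hx hx' => absurd hx hx')
      (fun a ha x hx hax => absurd (Finset.mem_singleton.1 ha ▸ hax) (hno x hx))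
    have h2 : ∀ w ∈ U \ {v}, G.nbrIn (U \ {v}) w = G.nbrIn U w := fun w hw => by
      ext x
      rw [mem_nbrIn, mem_nbrIn, Finset.mem_sdiff, Finset.mem_singleton]
      refine ⟨fun h => ⟨h.1.1, h.2⟩, fun h => ⟨⟨h.1, ?_⟩, h.2⟩⟩
      rintro rfl
      exact hno w (Finset.mem_sdiff.1 hw).1 h.2.symm
    have h3 : G.totalWeight U = G.totalWeight (U \ {v}) + weight (G.nbrIn U v).card := by
      rw [totalWeight, totalWeight, ← Finset.sum_sdiff (Finset.singleton_subset_iff.2 hv),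
        Finset.sum_singleton]
      congr 1
      exact Finset.sum_congr rfl fun w hw => by rw [h2 w hw]
    rw [hd, show weight 0 = 14 from rfl] at h3
    simp only [Finset.card_singleton] at h1
    convert_to G.totalWeight U < 14 * 1 + G.totalWeight (U \ {v}) at h1
    omega
  · exact hG.not_occurs_vertex degOne (by simp) (key 1 (by simp) hd)
  · exact hG.not_occurs_vertex degTwo (by simp) (key 2 (by simp) hd)
  · exact hG.not_occurs_vertex degThree (by simp) (key 3 (by simp) hd)

/-- A subcubic graph without 4-cycles satisfies the weight bound. -/
theorem Admissible.weightBound (h : G.Admissible U) : G.WeightBound U := by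
  induction hn : U.card using Nat.strong_induction_on generalizing G U with
  | _ n ih =>
    by_contra hcon
    exact not_minCex ⟨h, hcon, fun G' U' hlt h' => ih _ (hn ▸ hlt) h' rfl⟩

end SimpleGraph

namespace SimpleGraph

variable {V : Type*} {G : SimpleGraph V}

theorem hasNoFourCycle_iff : G.HasNoFourCycle ↔ ∀ a b c d, G.Adj a b → G.Adj b c → G.Adj c d →
    G.Adj d a → a = c ∨ b = d := by
  constructor
  · intro h a b c d hab hbc hcd hda
    by_contra! hne
    refine h a (.cons hab (.cons hbc (.cons hcd (.cons hda .nil)))) ?_ rfl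
    rw [Walk.cons_isCycle_iff]
    have h1 := hab.ne
    have h2 := hbc.ne
    have h3 := hcd.ne
    have h4 := hda.ne
    have h5 := hne.1
    have h6 := hne.2
    simp only [Walk.cons_isPath_iff, Walk.support_cons, Walk.support_nil, Walk.edges_cons,
      Walk.edges_nil, List.mem_cons, List.not_mem_nil, Sym2.eq_iff, Walk.isPath_iff_nil]
    grind
  · intro h v w hw hlen
    match w, hw, hlen with
    | .cons h1 (.cons h2 (.cons h3 (.cons h4 .nil))), hw, _ =>
      have hnd := hw.support_nodup
      simp only [Walk.support_cons, Walk.support_nil, List.tail_cons, List.nodup_cons,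
        List.mem_cons, List.not_mem_nil, or_false, not_or] at hnd
      rcases h _ _ _ _ h1 h2 h3 h4 with he | he
      · exact hnd.2.1.2 he.symm
      · exact hnd.1.2.1 he

theorem HasNoFourCycle.indepDomNum_le [Fintype V] [G.LocallyFinite] (h : G.HasNoFourCycle)
    (hG : G.IsRegularOfDegree 3) : 14 * G.indepDomNum ≤ 5 * Fintype.card V := by
  have hcard : ∀ v, (G.nbrIn Finset.univ v).card = 3 := fun v => by
    rw [← hG.degree_eq v, ← card_neighborFinset_eq_degree]
    congr 1
    ext w
    simp [mem_nbrIn]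
  have hadm : G.Admissible Finset.univ :=
    ⟨fun v _ => (hcard v).le, fun _ _ _ _ => hasNoFourCycle_iff.1 h _ _ _ _⟩
  obtain ⟨k, ⟨I, -, hI, hId, hIk⟩, hk⟩ := hadm.weightBound
  have hw : G.totalWeight Finset.univ = Fintype.card V * 5 := by
    simp [totalWeight, hcard, PGraph.weight]
  have hi : G.indepDomNum ≤ I.card := Nat.sInf_le
    ⟨I, ⟨fun v hv => by simpa using hId v (Finset.mem_univ v) (by simpa using hv),
      fun a ha b hb _ => hI a ha b hb⟩, rfl⟩
  omega

theorem hasNoFourCycle_of_le_egirth (h : 6 ≤ G.egirth) : G.HasNoFourCycle := by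
  intro v c hc hlen
  have := h.trans (egirth_le_length hc)
  rw [hlen] at this
  exact absurd this (by decide)

/-- Each independent dominating set that contains `L` has at least `k` further vertices: some
vertex is not dominated by `L`, and after adding any of its dominators `k - 1` are still needed. -/
def Needs (G : SimpleGraph V) : ℕ → List V → Prop
  | 0, _ => True
  | k + 1, L => ∃ v, (∀ a ∈ L, a ≠ v ∧ ¬ G.Adj v a) ∧
      ∀ b, (b = v ∨ G.Adj v b) → (∀ a ∈ L, ¬ G.Adj a b) → Needs G k (b :: L)

instance Needs.decidable [Fintype V] [DecidableEq V] [DecidableRel G.Adj] :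
    ∀ k L, Decidable (G.Needs k L)
  | 0, _ => .isTrue trivial
  | k + 1, L =>
    have : ∀ L, Decidable (G.Needs k L) := Needs.decidable k
    inferInstanceAs (Decidable (∃ v, (∀ a ∈ L, a ≠ v ∧ ¬ G.Adj v a) ∧
      ∀ b, (b = v ∨ G.Adj v b) → (∀ a ∈ L, ¬ G.Adj a b) → Needs G k (b :: L)))

theorem Needs.le_card {S : Finset V} (hS : G.IsIndepDominatingSet (S : Set V)) {k : ℕ} :
    ∀ {L : List V}, G.Needs k L → L.Nodup → (∀ a ∈ L, a ∈ S) → L.length + k ≤ S.card := by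
  classical
  induction k with
  | zero =>
    intro L _ hL hLS
    rw [Nat.add_zero, ← List.toFinset_card_of_nodup hL]
    exact Finset.card_le_card fun a ha => hLS a (List.mem_toFinset.1 ha)
  | succ k ih =>
    rintro L ⟨v, hv, hb⟩ hL hLS
    obtain ⟨b, hbS, hvb⟩ : ∃ b ∈ S, b = v ∨ G.Adj v b := by
      by_cases hvS : v ∈ S
      · exact ⟨v, hvS, Or.inl rfl⟩
      · obtain ⟨b, hbS, hvb⟩ := hS.1 v hvS
        exact ⟨b, hbS, Or.inr hvb⟩
    have hnot : b ∉ L := fun hbL => hvb.elim (hv b hbL).1 (hv b hbL).2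
    have := ih (hb b hvb fun a ha hab => hS.2 (hLS a ha) hbS hab.ne hab)
      (List.nodup_cons.2 ⟨hnot, hL⟩) (List.forall_mem_cons.2 ⟨hbS, hLS⟩)
    rw [List.length_cons] at this
    omega

/-- The generalized Petersen graph with 14 vertices and steps 1 and 2. -/
def petersenSeven : SimpleGraph (Fin 14) :=
  fromRel fun a b => (a.val < 7 ∧ (b.val = (a + 1) % 7 ∨ b.val = a + 7)) ∨
    (7 ≤ a.val ∧ b.val = 7 + (a - 7 + 2) % 7)

instance : DecidableRel petersenSeven.Adj := fun a b => by
  unfold petersenSeven; infer_instance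

theorem petersenSeven_isRegularOfDegree : petersenSeven.IsRegularOfDegree 3 := by
  unfold IsRegularOfDegree
  decide +kernel

theorem petersenSeven_eq_of_adj : ∀ a b c d, petersenSeven.Adj a b → petersenSeven.Adj b c →
    petersenSeven.Adj c d → petersenSeven.Adj d a → a = c ∨ b = d := by
  have : ∀ a b, petersenSeven.Adj a b → ∀ c, petersenSeven.Adj b c → ∀ d,
    petersenSeven.Adj c d → petersenSeven.Adj d a → a = c ∨ b = d := by decide +kernel
  exact fun a b c d h1 h2 => this a b h1 c h2 d

theorem petersenSeven_hasNoFourCycle : petersenSeven.HasNoFourCycle :=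
  hasNoFourCycle_iff.2 petersenSeven_eq_of_adj

theorem petersenSeven_not_adj : ∀ a b, petersenSeven.Adj a b → ∀ c, petersenSeven.Adj b c →
    ¬ petersenSeven.Adj c a := by
  decide +kernel

theorem petersenSeven_egirth : petersenSeven.egirth = 5 := by
  apply le_antisymm
  · have h1 : petersenSeven.Adj 0 1 := by decide
    have h2 : petersenSeven.Adj 1 2 := by decide
    have h3 : petersenSeven.Adj 2 9 := by decide
    have h4 : petersenSeven.Adj 9 7 := by decide
    have h5 : petersenSeven.Adj 7 0 := by decide
    refine egirth_le_length (w := .cons h1 (.cons h2 (.cons h3 (.cons h4 (.cons h5 .nil))))) ?_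
    rw [Walk.cons_isCycle_iff]
    simp
  · rw [le_egirth]
    intro v c hc
    by_contra! hlt
    have hlt' : c.length < 5 := by exact_mod_cast hlt
    have h3 := hc.three_le_length
    have h4 := petersenSeven_hasNoFourCycle v c hc
    have hlen : c.length = 3 := by omega
    match c, hlen with
    | .cons h1 (.cons h2 (.cons h3 .nil)), _ => exact petersenSeven_not_adj _ _ h1 _ h2 h3

theorem petersenSeven_indepDomNum : petersenSeven.indepDomNum = 5 := by
  apply le_antisymm
  · refine Nat.sInf_le ⟨{0, 2, 4, 8, 12}, ⟨?_, ?_⟩, by decide⟩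
    · simp only [IsDominatingSet, Finset.mem_coe]
      decide +kernel
    · have : ∀ a ∈ ({0, 2, 4, 8, 12} : Finset (Fin 14)), ∀ b ∈ ({0, 2, 4, 8, 12} : Finset (Fin 14)),
        ¬ petersenSeven.Adj a b := by decide +kernel
      exact fun a ha b hb _ => this a ha b hb
  · obtain ⟨S, hS, hcard⟩ := petersenSeven.exists_isIndepDominatingSet_card_eq
    have hneeds : petersenSeven.Needs 5 [] := by decide +kernel
    rw [← hcard]
    simpa using hneeds.le_card hS List.nodup_nil (by simp)

end SimpleGraph

theorem mainTheorem2 :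
    -- the bound for cubic graphs without 4-cycles
    (∀ (V : Type*) [Fintype V] (G : SimpleGraph V) [G.LocallyFinite],
      G.IsRegularOfDegree 3 → G.HasNoFourCycle →
        (G.indepDomNum : ℝ) ≤ 5 / 14 * (Fintype.card V : ℝ)) ∧
    -- it applies to girth at least 6 and is then better than the bound 4/11
    (∀ (V : Type*) [Fintype V] [Nonempty V] (G : SimpleGraph V) [G.LocallyFinite],
      G.IsRegularOfDegree 3 → 6 ≤ G.egirth →
        G.HasNoFourCycle ∧
        (G.indepDomNum : ℝ) ≤ 5 / 14 * (Fintype.card V : ℝ) ∧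
        5 / 14 * (Fintype.card V : ℝ) < 4 / 11 * (Fintype.card V : ℝ)) ∧
    -- tightness, by a graph of girth 5 with 14 vertices
    (∃ (G : SimpleGraph (Fin 14)) (_ : G.LocallyFinite),
      G.IsRegularOfDegree 3 ∧ G.HasNoFourCycle ∧ G.egirth = 5 ∧ G.indepDomNum = 5) := by
  refine ⟨fun V _ G _ hG h => ?_, fun V _ _ G _ hG hg => ?_, SimpleGraph.petersenSeven,
    inferInstance, SimpleGraph.petersenSeven_isRegularOfDegree,
    SimpleGraph.petersenSeven_hasNoFourCycle, SimpleGraph.petersenSeven_egirth,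
    SimpleGraph.petersenSeven_indepDomNum⟩
  · have : (14 * G.indepDomNum : ℝ) ≤ 5 * Fintype.card V := by
      exact_mod_cast h.indepDomNum_le hG
    linarith
  · have h := SimpleGraph.hasNoFourCycle_of_le_egirth hg
    have h1 : (14 * G.indepDomNum : ℝ) ≤ 5 * Fintype.card V := by
      exact_mod_cast h.indepDomNum_le hG
    have h2 : (0 : ℝ) < Fintype.card V := by exact_mod_cast Fintype.card_pos
    exact ⟨h, by linarith, by linarith⟩
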